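/- **Setting.** Let $(\Omega,\mathcal F)$ be a measurable space and $\mathcal H$ a set of real random variables on it such that $I_A\in\mathcal H$ for all $A\in\mathcal F$, and $\varphi(Y_1,\dots,Y_n)\in\mathcal H$ whenever $Y_1,\dots,Y_n\in\mathcal H$ and $\varphi:\mathbb R^n\to\mathbb R$ satisfies $|\varphi(x)-\varphi(y)|\le C(1+|x|^m+|y|^m)|x-y|$ for some $C>0$, $m\in\mathbb N$. Let $\mathbb E:\mathcal H\to[-\infty,\infty]$ be a sublinear expectation: for $Y,Z\in\mathcal H$, $\mathbb E[Y]\le\mathbb E[Z]$ if $Y\le Z$; $\mathbb E[c]=c$ for $c\in\mathbb R$; $\mathbb E[\lambda Y]=\lambda\mathbb E[Y]$ for $\lambda\ge0$; and $\mathbb E[Y+Z]\le\mathbb E[Y]+\mathbb E[Z]$ unless the right side is of the form $\infty-\infty$ or $-\infty+\infty$. Assume that $\mathbb E$ is countably sub-additive: $\mathbb E[Y]\le\sum_{n\ge1}\mathbb E[Y_n]$ whenever $Y,Y_n\in\mathcal H$ are nonnegative and $Y\le\sum_{n\ge1}Y_n$. Put $V(A)=\inf\{\mathbb E[\xi]:\xi\in\mathcal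 H,\ I_A\le\xi\}$ and $$C_V(Y)=\int_0^\infty V(Y>x)\,dx+\int_{-\infty}^0\bigl(V(Y>x)-1\bigr)\,dx .$$ A random vector $\mathbf Y$ is independent of $\mathbf X$ if $\mathbb E[\psi(\mathbf X,\mathbf Y)]=\mathbb E\bigl[\mathbb E[\psi(x,\mathbf Y)]|_{x=\mathbf X}\bigr]$ for every Borel function $\psi$ with $\psi(\mathbf X,\mathbf Y)\in\mathcal H$ and $\psi(x,\mathbf Y)\in\mathcal H$ for all $x$, for which $\bar\psi(x):=\mathbb E|\psi(x,\mathbf Y)|<\infty$ for all $x$ and $\mathbb E[\bar\psi(\mathbf X)]<\infty$ (all functions to which $\mathbb E$ is applied being in $\mathcal H$). A sequence $X_1,X_2,\dots\in\mathcal H$ is independent if $X_{n+1}$ is independent of $(X_1,\dots,X_n)$ for each $n\ge1$. Two random variables $Y,Z\in\mathcal H$ are identically distributed if $\mathbb E[\psi(Y)]=\mathbb E[\psi(Z)]$ for every Borel function $\psi$ with $\psi(Y),\psi(Z)\in\mathcal H$ for which both expectations are finite. **Theorem 3.2.** Let $X_1,X_2,\dots\in\mathcal H$ be independent and each identically distributed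 as $X\in\mathcal H$. Let $r>1$, $p>\tfrac12$, $\beta+p>0$, and if $p\le1$ suppose that $\mathbb E[X]=-\mathbb E[-X]=0$. Let $(a_{ni})_{0\le i\le n-1,\,n\ge1}$ be a triangular array of real numbers with $a_{ni}\approx\left(\frac{n-i}{n}\right)^{\beta}\left(\frac1n\right)^{p}$, that is, there are constants $c,C>0$ such that, for all sufficiently large $n$ and all $0\le i\le n-1$, $$c\left(\tfrac{n-i}{n}\right)^{\beta}n^{-p}\le a_{ni}\le C\left(\tfrac{n-i}{n}\right)^{\beta}n^{-p}.$$ Then the following are equivalent: (i) $C_V\bigl(|X|^{(r-1)/(p+\beta)}\bigr)<\infty$ if $-p<\beta<-p/r$; $C_V\bigl(|X|^{r/p}\ln(1+|X|)\bigr)<\infty$ if $\beta=-p/r$; $C_V\bigl(|X|^{r/p}\bigr)<\infty$ if $\beta>-p/r$; (ii) for every $\varepsilon>0$, $$\sum_{n=1}^\infty n^{r-2}\,V\Bigl(\max_{0\le j\le n-1}\Bigl|\sum_{i=1}^{j}a_{ni}X_i\Bigr|>\varepsilon\Bigr)<\infty .$$ -/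

import Mathlib

open scoped ENNReal

noncomputable section

/-- `C_{l,Lip}(ℝⁿ)`: functions with `|φ x - φ y| ≤ C (1 + |x|^m + |y|^m) |x - y|` for some `C > 0`
and `m ∈ ℕ`. The class does not depend on the norm chosen on `ℝⁿ`. -/
def LocLipPoly {n : ℕ} (φ : (Fin n → ℝ) → ℝ) : Prop :=
  ∃ C : ℝ, 0 < C ∧ ∃ m : ℕ, ∀ x y : Fin n → ℝ,
    |φ x - φ y| ≤ C * (1 + ‖x‖ ^ m + ‖y‖ ^ m) * ‖x - y‖

/-- A sublinear expectation space `(Ω, H, E)` over the measurable space `Ω`. The functional `E` is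
only meaningful on `H`; its values at functions outside `H` are never used. -/
structure SublinearExpectation (Ω : Type*) [MeasurableSpace Ω] where
  /-- the set of admissible random variables -/
  H : Set (Ω → ℝ)
  /-- the sublinear expectation, with values in `[-∞, ∞]` -/
  E : (Ω → ℝ) → EReal
  measurable_of_mem : ∀ X ∈ H, Measurable X
  indicator_mem : ∀ A : Set Ω, MeasurableSet A → A.indicator (fun _ => (1 : ℝ)) ∈ H
  comp_mem : ∀ (n : ℕ) (X : Fin n → Ω → ℝ) (φ : (Fin n → ℝ) → ℝ),
    (∀ i, X i ∈ H) → LocLipPoly φ → (fun ω => φ (fun i => X i ω)) ∈ H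
  mono : ∀ X ∈ H, ∀ Y ∈ H, (∀ ω, Y ω ≤ X ω) → E Y ≤ E X
  const : ∀ c : ℝ, E (fun _ => c) = (c : EReal)
  pos_homog : ∀ X ∈ H, ∀ c : ℝ, 0 ≤ c → E (fun ω => c * X ω) = (c : EReal) * E X
  subadd : ∀ X ∈ H, ∀ Y ∈ H, ¬ (E X = ⊤ ∧ E Y = ⊥) → ¬ (E X = ⊥ ∧ E Y = ⊤) →
    E (fun ω => X ω + Y ω) ≤ E X + E Y

namespace SublinearExpectation

/-- Countable sub-additivity: `E X ≤ ∑ E Xₙ` whenever `X ≤ ∑ Xₙ` with `X, Xₙ ∈ H` nonnegative. Both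
sums are sums of nonnegative terms and are taken in `[0, ∞]`. -/
def CountablySubadditive {Ω : Type*} [MeasurableSpace Ω] (S : SublinearExpectation Ω) : Prop :=
  ∀ (X : Ω → ℝ) (Z : ℕ → Ω → ℝ), X ∈ S.H → (∀ n, Z n ∈ S.H) →
    (∀ ω, 0 ≤ X ω) → (∀ n ω, 0 ≤ Z n ω) →
    (∀ ω, ENNReal.ofReal (X ω) ≤ ∑' n, ENNReal.ofReal (Z n ω)) →
    (S.E X).toENNReal ≤ ∑' n, (S.E (Z n)).toENNReal

/-- The upper capacity `V(A) = inf {E ξ : I_A ≤ ξ, ξ ∈ H}`. The infimum lies in `[0, 1]` for every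
measurable `A` (see `coe_capacity` and `capacity_le_one`), so it is recorded in `[0, ∞]`. -/
def capacity {Ω : Type*} [MeasurableSpace Ω] (S : SublinearExpectation Ω) (A : Set Ω) : ℝ≥0∞ :=
  (sInf (S.E '' {ξ | ξ ∈ S.H ∧ ∀ ω, A.indicator (fun _ => (1 : ℝ)) ω ≤ ξ ω})).toENNReal

theorem const_mem {Ω : Type*} [MeasurableSpace Ω] (S : SublinearExpectation Ω) (c : ℝ) :
    (fun _ : Ω => c) ∈ S.H :=
  S.comp_mem 0 (fun i => i.elim0) (fun _ => c) (fun i => i.elim0)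
    ⟨1, one_pos, 0, fun x y => by rw [sub_self, abs_zero]; positivity⟩

theorem coe_capacity {Ω : Type*} [MeasurableSpace Ω] (S : SublinearExpectation Ω) (A : Set Ω) :
    (S.capacity A : EReal) =
      sInf (S.E '' {ξ | ξ ∈ S.H ∧ ∀ ω, A.indicator (fun _ => (1 : ℝ)) ω ≤ ξ ω}) := by
  refine EReal.coe_toENNReal (le_sInf ?_)
  rintro _ ⟨ξ, ⟨hξ, hA⟩, rfl⟩
  have h := S.mono ξ hξ _ (S.const_mem 0)
    (fun ω => (Set.indicator_nonneg (fun _ _ => zero_le_one) ω).trans (hA ω))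
  rwa [S.const, EReal.coe_zero] at h

theorem capacity_le_one {Ω : Type*} [MeasurableSpace Ω] (S : SublinearExpectation Ω)
    (A : Set Ω) : S.capacity A ≤ 1 := by
  have h : (S.capacity A : EReal) ≤ ((1 : ℝ≥0∞) : EReal) := by
    rw [coe_capacity]
    refine sInf_le ⟨fun _ => 1, ⟨S.const_mem 1, fun ω => ?_⟩, by simp [S.const]⟩
    exact Set.indicator_le_self' (fun _ _ => zero_le_one) ω
  exact_mod_cast h

/-- The Choquet expectation
`C_V(X) = ∫_0^∞ V(X > x) dx + ∫_{-∞}^0 (V(X > x) - 1) dx ∈ [-∞, ∞]`. -/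
def choquet {Ω : Type*} [MeasurableSpace Ω] (S : SublinearExpectation Ω) (X : Ω → ℝ) : EReal :=
  ((∫⁻ x in Set.Ioi (0 : ℝ), S.capacity {ω | x < X ω} : ℝ≥0∞) : EReal) -
    ((∫⁻ x in Set.Iio (0 : ℝ), (1 - S.capacity {ω | x < X ω}) : ℝ≥0∞) : EReal)

/-- `Y` is independent of `X`: for each Borel `ψ` with `ψ(X, Y) ∈ H` and `ψ(x, Y) ∈ H` for all `x`,
`E[ψ(X, Y)] = E[E[ψ(x, Y)]|_{x = X}]` whenever `E|ψ(x, Y)| < ∞` for all `x` and the expectation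
of `E|ψ(x, Y)|` at `x = X` is finite. As `E` is defined on `H` only, the two functions of `X` whose
expectation is taken are required to lie in `H`. The numbers `E[ψ(x, Y)]`, `E|ψ(x, Y)|` are finite
here, so that `EReal.toReal` does not change them. -/
def IndepOf {Ω α β : Type*} [MeasurableSpace Ω] [MeasurableSpace α] [MeasurableSpace β]
    (S : SublinearExpectation Ω) (Y : Ω → β) (X : Ω → α) : Prop :=
  ∀ ψ : α × β → ℝ, Measurable ψ →
    (fun ω => ψ (X ω, Y ω)) ∈ S.H →
    (∀ x, (fun ω => ψ (x, Y ω)) ∈ S.H) →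
    (∀ x, S.E (fun ω => |ψ (x, Y ω)|) < ⊤) →
    (fun ω => (S.E (fun ω' => |ψ (X ω, Y ω')|)).toReal) ∈ S.H →
    S.E (fun ω => |(S.E (fun ω' => |ψ (X ω, Y ω')|)).toReal|) < ⊤ →
    (fun ω => (S.E (fun ω' => ψ (X ω, Y ω'))).toReal) ∈ S.H →
    S.E (fun ω => ψ (X ω, Y ω)) = S.E (fun ω => (S.E (fun ω' => ψ (X ω, Y ω'))).toReal)

/-- `X₁, X₂, …` is a sequence of independent random variables (the entry `X 0` plays no role):
`X_{n+1}` is independent of `(X₁, …, Xₙ)` for each `n ≥ 1`. -/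
def IndepSeq {Ω : Type*} [MeasurableSpace Ω] (S : SublinearExpectation Ω)
    (X : ℕ → Ω → ℝ) : Prop :=
  ∀ n : ℕ, 1 ≤ n → S.IndepOf (X (n + 1)) (fun ω (i : Fin n) => X (i + 1) ω)

/-- `X` and `Y` are identically distributed: `E[ψ(X)] = E[ψ(Y)]` for each Borel `ψ` with
`ψ(X), ψ(Y) ∈ H`, whenever these sublinear expectations are finite. -/
def IdentDistrib {Ω : Type*} [MeasurableSpace Ω] (S : SublinearExpectation Ω)
    (X Y : Ω → ℝ) : Prop :=
  ∀ ψ : ℝ → ℝ, Measurable ψ → (fun ω => ψ (X ω)) ∈ S.H → (fun ω => ψ (Y ω)) ∈ S.H →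
    S.E (fun ω => ψ (X ω)) ≠ ⊤ → S.E (fun ω => ψ (X ω)) ≠ ⊥ →
    S.E (fun ω => ψ (Y ω)) ≠ ⊤ → S.E (fun ω => ψ (Y ω)) ≠ ⊥ →
    S.E (fun ω => ψ (X ω)) = S.E (fun ω => ψ (Y ω))

end SublinearExpectation

/-- `a_{ni} ≈ b_{ni}`, `0 ≤ i ≤ n - 1`: there are constants `c, C > 0`, not depending on `n` and `i`,
with `c b_{ni} ≤ a_{ni} ≤ C b_{ni}` for all `n` large enough and all `0 ≤ i ≤ n - 1`. -/
def ArrayApprox (a b : ℕ → ℕ → ℝ) : Prop :=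
  ∃ c C : ℝ, 0 < c ∧ 0 < C ∧ ∃ N : ℕ, ∀ n ≥ N, ∀ i < n, c * b n i ≤ a n i ∧ a n i ≤ C * b n i

/-- `max_{0 ≤ j ≤ n - 1} |∑_{i=1}^{j} a_{ni} X_i|` for `n ≥ 1` (the empty sum, `j = 0`, is `0`). -/
def maxAbsWeightedSum {Ω : Type*} (a : ℕ → ℕ → ℝ) (X : ℕ → Ω → ℝ) (n : ℕ+) (ω : Ω) : ℝ :=
  (Finset.range n).sup' (Finset.nonempty_range_iff.2 n.ne_zero)
    (fun j => |∑ i ∈ Finset.Icc 1 j, a n i * X i ω|)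

end

/-!
Write `α = p + β` and `k = n - i`, so that `a_{ni}` is of order `k^β n^{-α}`. The summand
`a_{ni} X_i` is then large when `|X|` exceeds the threshold `n^α k^{-β}`, and summation by levels,
with the number of pairs `k < n` below a given threshold weighted by `n^{r-2}`, shows that the
moment condition is equivalent to `∑ n^{r-2} ∑_{k < n} V(|X| > δ n^α k^{-β}) < ∞`, for one `δ > 0`
or for all of them.

If this double sum is finite, the probability of a large summand is summable, and for the clipped
summands Bernstein's inequality applies: it follows by Chernoff's method from a Ville inequality
for the product `∏ q_i(X_i)` frozen at its first passage, which replaces the supermartingale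
argument. Conversely, a large summand forces a large partial sum, and independence bounds the
capacity of a large summand in row `n` from below by `1 - exp(-∑_{k < n} V(|X| > δ n^α k^{-β}))`.
The inner sums vary slowly enough that convergence makes them small, and then `1 - exp(-u)` is
comparable with `u`.
-/

/-! ### Bounded random variables and capacities -/

noncomputable section

theorem LocLipPoly.of_lipschitzWith {n : ℕ} {φ : (Fin n → ℝ) → ℝ} {K : NNReal}
    (hφ : LipschitzWith K φ) : LocLipPoly φ := by
  refine ⟨K + 1, by positivity, 0, fun x y => ?_⟩
  calc |φ x - φ y| ≤ K * ‖x - y‖ := hφ.norm_sub_le x y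
    _ ≤ (K + 1) * (1 + ‖x‖ ^ 0 + ‖y‖ ^ 0) * ‖x - y‖ := by
      gcongr
      simp only [pow_zero]
      linarith [K.coe_nonneg]

theorem locLipPoly_mul : LocLipPoly fun x : Fin 2 → ℝ => x 0 * x 1 := by
  refine ⟨1, one_pos, 1, fun x y => ?_⟩
  calc |x 0 * x 1 - y 0 * y 1| = |x 0 * (x 1 - y 1) + (x 0 - y 0) * y 1| := by ring_nf
    _ ≤ |x 0| * |x 1 - y 1| + |x 0 - y 0| * |y 1| := by
      rw [← abs_mul, ← abs_mul]
      exact abs_add_le _ _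
    _ ≤ ‖x‖ * ‖x - y‖ + ‖x - y‖ * ‖y‖ := by
      gcongr
      · exact norm_le_pi_norm x 0
      · exact norm_le_pi_norm (x - y) 1
      · exact norm_le_pi_norm (x - y) 0
      · exact norm_le_pi_norm y 1
    _ ≤ 1 * (1 + ‖x‖ ^ 1 + ‖y‖ ^ 1) * ‖x - y‖ := by linarith [norm_nonneg (x - y)]

namespace SublinearExpectation

variable {Ω : Type*} [MeasurableSpace Ω] (S : SublinearExpectation Ω)

theorem add_mem {X Y : Ω → ℝ} (hX : X ∈ S.H) (hY : Y ∈ S.H) :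
    (fun ω => X ω + Y ω) ∈ S.H :=
  S.comp_mem 2 ![X, Y] (fun x => x 0 + x 1) (Fin.forall_fin_two.2 ⟨hX, hY⟩)
    (.of_lipschitzWith ((LipschitzWith.eval 0).add (LipschitzWith.eval 1)))

theorem mul_mem {X Y : Ω → ℝ} (hX : X ∈ S.H) (hY : Y ∈ S.H) :
    (fun ω => X ω * Y ω) ∈ S.H :=
  S.comp_mem 2 ![X, Y] (fun x => x 0 * x 1) (Fin.forall_fin_two.2 ⟨hX, hY⟩) locLipPoly_mul

theorem const_mul_mem (c : ℝ) {X : Ω → ℝ} (hX : X ∈ S.H) : (fun ω => c * X ω) ∈ S.H :=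
  S.mul_mem (S.const_mem c) hX

theorem lipschitzWith_comp_mem {f : ℝ → ℝ} {K : NNReal} (hf : LipschitzWith K f) {X : Ω → ℝ}
    (hX : X ∈ S.H) : (fun ω => f (X ω)) ∈ S.H :=
  S.comp_mem 1 (fun _ => X) (fun x => f (x 0)) (fun _ => hX)
    (.of_lipschitzWith (hf.comp (LipschitzWith.eval 0)))

theorem abs_mem {X : Ω → ℝ} (hX : X ∈ S.H) : (fun ω => |X ω|) ∈ S.H :=
  S.lipschitzWith_comp_mem lipschitzWith_one_norm hX

/-- Bounded admissible random variables, the class on which `E` takes real values. -/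
def IsBdd (ξ : Ω → ℝ) : Prop := ξ ∈ S.H ∧ ∃ M : ℝ, ∀ ω, |ξ ω| ≤ M

/-- The sublinear expectation of a bounded admissible random variable, as a real number; it is
junk where `E` is infinite. -/
def ev (ξ : Ω → ℝ) : ℝ := (S.E ξ).toReal

variable {S} {ξ η : Ω → ℝ} {A B : Set Ω}

theorem isBdd_const (c : ℝ) : S.IsBdd (fun _ => c) := ⟨S.const_mem c, |c|, fun _ => le_rfl⟩

theorem IsBdd.add (hξ : S.IsBdd ξ) (hη : S.IsBdd η) : S.IsBdd (fun ω => ξ ω + η ω) := by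
  obtain ⟨hξH, M, hM⟩ := hξ
  obtain ⟨hηH, N, hN⟩ := hη
  exact ⟨S.add_mem hξH hηH, M + N, fun ω => (abs_add_le _ _).trans (add_le_add (hM ω) (hN ω))⟩

theorem IsBdd.mul (hξ : S.IsBdd ξ) (hη : S.IsBdd η) : S.IsBdd (fun ω => ξ ω * η ω) := by
  obtain ⟨hξH, M, hM⟩ := hξ
  obtain ⟨hηH, N, hN⟩ := hη
  refine ⟨S.mul_mem hξH hηH, M * N, fun ω => ?_⟩
  rw [abs_mul]
  exact mul_le_mul (hM ω) (hN ω) (abs_nonneg _) ((abs_nonneg _).trans (hM ω))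

theorem isBdd_indicator_one (hA : MeasurableSet A) : S.IsBdd (A.indicator fun _ => 1) :=
  ⟨S.indicator_mem A hA, 1, fun ω => by by_cases h : ω ∈ A <;> simp [h]⟩

theorem IsBdd.indicator (hξ : S.IsBdd ξ) (hA : MeasurableSet A) : S.IsBdd (A.indicator ξ) := by
  have h := hξ.mul (isBdd_indicator_one hA)
  rwa [show (fun ω => ξ ω * A.indicator (fun _ => 1) ω) = A.indicator ξ from
    funext fun ω => by by_cases hω : ω ∈ A <;> simp [hω]] at h

theorem IsBdd.coe_ev (hξ : S.IsBdd ξ) : (S.ev ξ : EReal) = S.E ξ := by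
  obtain ⟨hξH, M, hM⟩ := hξ
  have hle := S.mono _ (S.const_mem M) ξ hξH (fun ω => (le_abs_self _).trans (hM ω))
  have hge := S.mono ξ hξH _ (S.const_mem (-M)) (fun ω => neg_le_of_abs_le (hM ω))
  rw [S.const] at hle hge
  exact EReal.coe_toReal (ne_top_of_le_ne_top (EReal.coe_ne_top M) hle)
    (ne_bot_of_le_ne_bot (EReal.coe_ne_bot _) hge)

theorem ev_mono (hξ : S.IsBdd ξ) (hη : S.IsBdd η) (hle : ∀ ω, ξ ω ≤ η ω) : S.ev ξ ≤ S.ev η := by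
  rw [← EReal.coe_le_coe_iff, hξ.coe_ev, hη.coe_ev]
  exact S.mono _ hη.1 _ hξ.1 hle

theorem ev_const (c : ℝ) : S.ev (fun _ => c) = c := by
  rw [ev, S.const, EReal.toReal_coe]

theorem ev_nonneg (hξ : S.IsBdd ξ) (h0 : ∀ ω, 0 ≤ ξ ω) : 0 ≤ S.ev ξ :=
  (ev_const 0).symm.trans_le (ev_mono (isBdd_const 0) hξ h0)

theorem ev_add_le (hξ : S.IsBdd ξ) (hη : S.IsBdd η) :
    S.ev (fun ω => ξ ω + η ω) ≤ S.ev ξ + S.ev η := by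
  rw [← EReal.coe_le_coe_iff, (hξ.add hη).coe_ev, EReal.coe_add, hξ.coe_ev, hη.coe_ev]
  refine S.subadd _ hξ.1 _ hη.1 ?_ ?_ <;> rw [← hξ.coe_ev, ← hη.coe_ev] <;> simp

theorem ev_const_mul (hξ : S.IsBdd ξ) {c : ℝ} (hc : 0 ≤ c) :
    S.ev (fun ω => c * ξ ω) = c * S.ev ξ := by
  rw [← EReal.coe_eq_coe_iff, ((isBdd_const c).mul hξ).coe_ev, EReal.coe_mul, hξ.coe_ev,
    S.pos_homog _ hξ.1 _ hc]

theorem ev_const_add (hξ : S.IsBdd ξ) (c : ℝ) : S.ev (fun ω => c + ξ ω) = c + S.ev ξ := by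
  apply le_antisymm
  · simpa only [ev_const] using ev_add_le (isBdd_const c) hξ
  · have h := ev_add_le (isBdd_const (-c)) ((isBdd_const c).add hξ)
    simp only [ev_const, neg_add_cancel_left] at h
    linarith

theorem capacity_mono (h : A ⊆ B) : S.capacity A ≤ S.capacity B := by
  refine EReal.toENNReal_le_toENNReal (sInf_le_sInf (Set.image_mono ?_))
  rintro ξ ⟨hξ, hB⟩
  exact ⟨hξ, fun ω =>
    (Set.indicator_le_indicator_of_subset h (fun _ => zero_le_one) ω).trans (hB ω)⟩

theorem capacity_ne_top (A : Set Ω) : S.capacity A ≠ ⊤ :=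
  ((S.capacity_le_one A).trans_lt ENNReal.one_lt_top).ne

theorem ev_indicator_one (hA : MeasurableSet A) :
    S.ev (A.indicator fun _ => 1) = (S.capacity A).toReal := by
  have hinf : IsLeast (S.E '' {ξ | ξ ∈ S.H ∧ ∀ ω, A.indicator (fun _ => (1 : ℝ)) ω ≤ ξ ω})
      (S.E (A.indicator fun _ => 1)) := by
    refine ⟨⟨_, ⟨S.indicator_mem A hA, fun _ => le_rfl⟩, rfl⟩, ?_⟩
    rintro _ ⟨ξ, ⟨hξ, hle⟩, rfl⟩
    exact S.mono _ hξ _ (S.indicator_mem A hA) hle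
  rw [ev, ← hinf.isGLB.sInf_eq, ← coe_capacity, EReal.toReal_coe_ennreal]

theorem capacity_eq_ofReal_ev (hA : MeasurableSet A) :
    S.capacity A = ENNReal.ofReal (S.ev (A.indicator fun _ => 1)) := by
  rw [ev_indicator_one hA, ENNReal.ofReal_toReal (capacity_ne_top A)]

theorem toReal_capacity_le_one (A : Set Ω) : (S.capacity A).toReal ≤ 1 :=
  ENNReal.toReal_mono ENNReal.one_ne_top (S.capacity_le_one A)

theorem capacity_univ : S.capacity Set.univ = 1 := by
  rw [capacity_eq_ofReal_ev MeasurableSet.univ, Set.indicator_univ, ev_const, ENNReal.ofReal_one]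

theorem capacity_empty : S.capacity ∅ = 0 := by
  rw [capacity_eq_ofReal_ev MeasurableSet.empty, Set.indicator_empty, ev_const, ENNReal.ofReal_zero]

theorem capacity_union_le (hA : MeasurableSet A) (hB : MeasurableSet B) :
    S.capacity (A ∪ B) ≤ S.capacity A + S.capacity B := by
  have hIA := isBdd_indicator_one (S := S) hA
  have hIB := isBdd_indicator_one (S := S) hB
  rw [← ENNReal.toReal_le_toReal (capacity_ne_top _)
      (ENNReal.add_ne_top.2 ⟨capacity_ne_top A, capacity_ne_top B⟩),
    ENNReal.toReal_add (capacity_ne_top A) (capacity_ne_top B),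
    ← ev_indicator_one hA, ← ev_indicator_one hB, ← ev_indicator_one (hA.union hB)]
  refine (ev_mono (isBdd_indicator_one (hA.union hB)) (hIA.add hIB) fun ω => ?_).trans
    (ev_add_le hIA hIB)
  by_cases hωA : ω ∈ A <;> by_cases hωB : ω ∈ B <;> simp [hωA, hωB]

theorem capacity_biUnion_le {ι : Type*} (s : Finset ι) {A : ι → Set Ω}
    (hA : ∀ i ∈ s, MeasurableSet (A i)) :
    S.capacity (⋃ i ∈ s, A i) ≤ ∑ i ∈ s, S.capacity (A i) := by
  classical
  induction s using Finset.induction_on with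
  | empty => simp [capacity_empty]
  | insert i s hi ih =>
    rw [Finset.forall_mem_insert] at hA
    rw [Finset.set_biUnion_insert, Finset.sum_insert hi]
    exact (capacity_union_le hA.1 (s.measurableSet_biUnion hA.2)).trans
      (add_le_add le_rfl (ih hA.2))

theorem capacity_le_ofReal_ev_div (hA : MeasurableSet A) (hξ : S.IsBdd ξ) (h0 : ∀ ω, 0 ≤ ξ ω)
    {t : ℝ} (ht : 0 < t) (hle : ∀ ω ∈ A, t ≤ ξ ω) :
    S.capacity A ≤ ENNReal.ofReal (S.ev ξ / t) := by
  rw [capacity_eq_ofReal_ev hA]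
  refine ENNReal.ofReal_le_ofReal ?_
  rw [le_div_iff₀ ht, mul_comm, ← ev_const_mul (isBdd_indicator_one hA) ht.le]
  refine ev_mono ((isBdd_const t).mul (isBdd_indicator_one hA)) hξ fun ω => ?_
  by_cases hω : ω ∈ A
  · simpa [hω] using hle ω hω
  · simpa [hω] using h0 ω

theorem IdentDistrib.ev_eq {X Y : Ω → ℝ} (h : S.IdentDistrib X Y) {f : ℝ → ℝ} (hf : Measurable f)
    (hX : S.IsBdd (fun ω => f (X ω))) (hY : S.IsBdd (fun ω => f (Y ω))) :
    S.ev (fun ω => f (X ω)) = S.ev (fun ω => f (Y ω)) := by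
  have hE := h f hf hX.1 hY.1
  rw [← hX.coe_ev, ← hY.coe_ev] at hE
  simpa using hE

theorem IdentDistrib.capacity_preimage_eq {X Y : Ω → ℝ} (h : S.IdentDistrib X Y)
    (hX : Measurable X) (hY : Measurable Y) {B : Set ℝ} (hB : MeasurableSet B) :
    S.capacity (X ⁻¹' B) = S.capacity (Y ⁻¹' B) := by
  rw [capacity_eq_ofReal_ev (hX hB), capacity_eq_ofReal_ev (hY hB)]
  exact congrArg _ (h.ev_eq (f := B.indicator fun _ => 1) (measurable_const.indicator hB)
    (isBdd_indicator_one (hX hB)) (isBdd_indicator_one (hY hB)))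

end SublinearExpectation

end

/-! ### Products over independent sequences -/

noncomputable section

open scoped MeasureTheory

namespace SublinearExpectation

section Past

variable {Ω : Type*} {X : ℕ → Ω → ℝ} {m : ℕ}

/-- The σ-algebra generated by `X₁, …, Xₘ`. -/
abbrev past (X : ℕ → Ω → ℝ) (m : ℕ) : MeasurableSpace Ω :=
  MeasurableSpace.comap (fun ω (i : Fin m) => X (i + 1) ω) inferInstance

theorem measurable_past (hm : 1 ≤ m) : Measurable[past X m] (X m) := by
  obtain ⟨m, rfl⟩ := Nat.exists_eq_add_of_le' hm
  exact (measurable_pi_apply (X := fun _ : Fin (m + 1) => ℝ) (Fin.last m)).comp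
    (comap_measurable _)

theorem past_le_succ : past X m ≤ past X (m + 1) := by
  refine Measurable.comap_le ?_
  exact (measurable_pi_lambda (fun (x : Fin (m + 1) → ℝ) (i : Fin m) => x i.castSucc)
    fun i => measurable_pi_apply i.castSucc).comp (comap_measurable _)

theorem exists_nonneg_eq_comp {ξ : Ω → ℝ} (hξ : Measurable[past X m] ξ) (h0 : ∀ ω, 0 ≤ ξ ω) :
    ∃ g : (Fin m → ℝ) → ℝ, Measurable g ∧ (∀ x, 0 ≤ g x) ∧
      ξ = fun ω => g (fun i => X (i + 1) ω) := by
  obtain ⟨g, hg, rfl⟩ := hξ.exists_eq_measurable_comp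
  exact ⟨fun x => max (g x) 0, hg.max measurable_const, fun x => le_max_right _ _,
    funext fun ω => (max_eq_left (h0 ω)).symm⟩

theorem measurableSet_past_biUnion {B : ℕ → Set ℝ} (hB : ∀ n, MeasurableSet (B n)) (m : ℕ) :
    MeasurableSet[past X m] (⋃ i ∈ Finset.Icc 1 m, X i ⁻¹' B i) := by
  induction m with
  | zero => simp
  | succ m ih =>
    rw [← Finset.insert_Icc_right_eq_Icc_add_one (Nat.succ_pos m), Finset.set_biUnion_insert]
    exact (measurable_past (Nat.succ_pos m) (hB _)).union (past_le_succ _ ih)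

end Past

variable {Ω : Type*} [MeasurableSpace Ω] {S : SublinearExpectation Ω}
variable {X : ℕ → Ω → ℝ} {m : ℕ}

theorem past_le (hX : ∀ n, 1 ≤ n → X n ∈ S.H) : past X m ≤ ‹MeasurableSpace Ω› :=
  Measurable.comap_le <|
    measurable_pi_lambda _ fun i => S.measurable_of_mem _ (hX _ (Nat.succ_pos i))

/-- For `Y` independent of `X`, the variable `Y` may be integrated out in `g(X) + h(X) ξ(Y)`. The
signs keep `|ψ| = ψ` in the definition of independence. -/
theorem IndepOf.ev_add_mul {α β : Type*} [MeasurableSpace α] [MeasurableSpace β]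
    {Y : Ω → β} {X : Ω → α} (hind : S.IndepOf Y X) {g h : α → ℝ} {ξ : β → ℝ}
    (hg : Measurable g) (hh : Measurable h) (hξ : Measurable ξ)
    (hgX : S.IsBdd (fun ω => g (X ω))) (hhX : S.IsBdd (fun ω => h (X ω)))
    (hξY : S.IsBdd (fun ω => ξ (Y ω))) (hg0 : ∀ x, 0 ≤ g x) (hh0 : ∀ x, 0 ≤ h x)
    (hξ0 : ∀ y, 0 ≤ ξ y) :
    S.ev (fun ω => g (X ω) + h (X ω) * ξ (Y ω)) =
      S.ev (fun ω => g (X ω) + h (X ω) * S.ev (fun ω' => ξ (Y ω'))) := by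
  set e := S.ev (fun ω => ξ (Y ω))
  have he0 : 0 ≤ e := ev_nonneg hξY fun ω => hξ0 _
  have habs (x y) : |g x + h x * ξ y| = g x + h x * ξ y :=
    abs_of_nonneg (add_nonneg (hg0 x) (mul_nonneg (hh0 x) (hξ0 y)))
  have hsection (x) : S.IsBdd (fun ω => g x + h x * ξ (Y ω)) :=
    (isBdd_const (g x)).add ((isBdd_const (h x)).mul hξY)
  have hev (x) : (S.E (fun ω => g x + h x * ξ (Y ω))).toReal = g x + h x * e := by
    change S.ev _ = _
    rw [ev_const_add ((isBdd_const (h x)).mul hξY), ev_const_mul hξY (hh0 x)]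
  have hbdd : S.IsBdd (fun ω => g (X ω) + h (X ω) * e) := hgX.add (hhX.mul (isBdd_const e))
  have hindep := hind (fun z => g z.1 + h z.1 * ξ z.2)
    ((hg.comp measurable_fst).add ((hh.comp measurable_fst).mul (hξ.comp measurable_snd)))
    (hgX.add (hhX.mul hξY)).1 (fun x => (hsection x).1)
  simp only [habs, hev, fun x => abs_of_nonneg (add_nonneg (hg0 x) (mul_nonneg (hh0 x) he0)),
    ← hbdd.coe_ev] at hindep
  refine congrArg EReal.toReal (hindep (fun x => ?_) hbdd.1 (EReal.coe_lt_top _) hbdd.1) |>.trans ?_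
  · rw [← (hsection x).coe_ev]
    exact EReal.coe_lt_top _
  · rw [EReal.toReal_coe]

/-- For `m = 0` this is not part of independence: the past is trivial there. -/
theorem IndepSeq.ev_add_mul (hind : S.IndepSeq X) {G H : Ω → ℝ} {ξ : ℝ → ℝ}
    (hG : Measurable[past X m] G) (hH : Measurable[past X m] H) (hξ : Measurable ξ)
    (hGb : S.IsBdd G) (hHb : S.IsBdd H) (hξb : S.IsBdd (fun ω => ξ (X (m + 1) ω)))
    (hG0 : ∀ ω, 0 ≤ G ω) (hH0 : ∀ ω, 0 ≤ H ω) (hξ0 : ∀ y, 0 ≤ ξ y) :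
    S.ev (fun ω => G ω + H ω * ξ (X (m + 1) ω)) =
      S.ev (fun ω => G ω + H ω * S.ev (fun ω' => ξ (X (m + 1) ω'))) := by
  obtain ⟨g, hg, hg0, rfl⟩ := exists_nonneg_eq_comp hG hG0
  obtain ⟨h, hh, hh0, rfl⟩ := exists_nonneg_eq_comp hH hH0
  rcases Nat.eq_zero_or_pos m with rfl | hm
  · have htriv (ω) : (fun i : Fin 0 => X (i + 1) ω) = Fin.elim0 := Subsingleton.elim _ _
    simp only [htriv]
    rw [ev_const_add ((isBdd_const _).mul hξb), ev_const_mul hξb (hh0 _), ev_const]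
  · exact (hind m hm).ev_add_mul hg hh hξ hGb hHb hξb hg0 hh0 hξ0

theorem IndepSeq.one_sub_capacity_union_preimage (hind : S.IndepSeq X) (hX : ∀ n, 1 ≤ n → X n ∈ S.H)
    {U : Set Ω} (hU : MeasurableSet[past X m] U) {B : Set ℝ} (hB : MeasurableSet B) :
    1 - (S.capacity (U ∪ X (m + 1) ⁻¹' B)).toReal =
      (1 - (S.capacity U).toReal) * (1 - (S.capacity (X (m + 1) ⁻¹' B)).toReal) := by
  set C := X (m + 1) ⁻¹' B
  have hUΩ : MeasurableSet U := past_le hX U hU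
  have hC : MeasurableSet C := S.measurable_of_mem _ (hX _ (Nat.succ_pos m)) hB
  have hint := hind.ev_add_mul (m := m) (G := U.indicator fun _ => 1)
    (H := Uᶜ.indicator fun _ => 1) (ξ := B.indicator fun _ => 1)
    (Measurable.indicator (m := past X m) measurable_const hU)
    (Measurable.indicator (m := past X m) measurable_const hU.compl)
    (measurable_const.indicator hB) (isBdd_indicator_one hUΩ)
    (isBdd_indicator_one hUΩ.compl) (isBdd_indicator_one hC)
    (Set.indicator_nonneg fun _ _ => zero_le_one)
    (Set.indicator_nonneg fun _ _ => zero_le_one) (Set.indicator_nonneg fun _ _ => zero_le_one)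
  set v := S.ev (fun ω => B.indicator (fun _ => 1) (X (m + 1) ω))
  have hv : v = (S.capacity C).toReal := ev_indicator_one hC
  have hleft : (fun ω => U.indicator (fun _ => (1 : ℝ)) ω +
      Uᶜ.indicator (fun _ => 1) ω * B.indicator (fun _ => 1) (X (m + 1) ω)) =
      (U ∪ C).indicator fun _ => 1 := by
    funext ω
    by_cases hωU : ω ∈ U <;> by_cases hωB : X (m + 1) ω ∈ B <;> simp [C, hωU, hωB]
  have hright : (fun ω => U.indicator (fun _ => (1 : ℝ)) ω + Uᶜ.indicator (fun _ => 1) ω * v) =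
      fun ω => v + (1 - v) * U.indicator (fun _ => 1) ω := by
    funext ω
    by_cases hωU : ω ∈ U <;> simp [hωU]
  have hv1 : 0 ≤ 1 - v := by linarith [toReal_capacity_le_one (S := S) C]
  rw [hleft, hright, ev_const_add ((isBdd_const _).mul (isBdd_indicator_one hUΩ)),
    ev_const_mul (isBdd_indicator_one hUΩ) hv1, ev_indicator_one (hUΩ.union hC),
    ev_indicator_one hUΩ, hv] at hint
  rw [hint]
  ring

theorem IndepSeq.one_sub_capacity_biUnion (hind : S.IndepSeq X) (hX : ∀ n, 1 ≤ n → X n ∈ S.H)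
    {B : ℕ → Set ℝ} (hB : ∀ n, MeasurableSet (B n)) (m : ℕ) :
    1 - (S.capacity (⋃ i ∈ Finset.Icc 1 m, X i ⁻¹' B i)).toReal =
      ∏ i ∈ Finset.Icc 1 m, (1 - (S.capacity (X i ⁻¹' B i)).toReal) := by
  induction m with
  | zero => simp [capacity_empty]
  | succ m ih =>
    rw [Finset.prod_Icc_succ_top (Nat.succ_pos m), ← ih,
      ← hind.one_sub_capacity_union_preimage hX (measurableSet_past_biUnion hB m) (hB (m + 1)),
      ← Finset.insert_Icc_right_eq_Icc_add_one (Nat.succ_pos m), Finset.set_biUnion_insert,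
      Set.union_comm]

theorem IndepSeq.one_sub_exp_le_capacity_biUnion (hind : S.IndepSeq X)
    (hX : ∀ n, 1 ≤ n → X n ∈ S.H) {B : ℕ → Set ℝ} (hB : ∀ n, MeasurableSet (B n)) (m : ℕ) :
    1 - Real.exp (-∑ i ∈ Finset.Icc 1 m, (S.capacity (X i ⁻¹' B i)).toReal) ≤
      (S.capacity (⋃ i ∈ Finset.Icc 1 m, X i ⁻¹' B i)).toReal := by
  rw [sub_le_comm, hind.one_sub_capacity_biUnion hX hB m, ← Finset.sum_neg_distrib, Real.exp_sum]
  exact Finset.prod_le_prod (fun i _ => sub_nonneg.2 (toReal_capacity_le_one _))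
    fun i _ => Real.one_sub_le_exp_neg _

end SublinearExpectation

end

/-! ### Maximal inequalities -/

noncomputable section

open scoped MeasureTheory

theorem measurableSet_exists_le_lt {Ω : Type*} [MeasurableSpace Ω] {f : ℕ → Ω → ℝ}
    (hf : ∀ j, Measurable (f j)) (m : ℕ) (t : ℝ) : MeasurableSet {ω | ∃ j ≤ m, t < f j ω} := by
  simp only [Set.ofPred_exists, Set.ofPred_and]
  exact .iUnion fun j => (MeasurableSet.const _).inter (measurableSet_lt measurable_const (hf j))

theorem exp_le_one_add_add_sq {u c : ℝ} (hu : |u| ≤ c) :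
    Real.exp u ≤ 1 + u + Real.exp c * u ^ 2 := by
  have hc : 1 ≤ Real.exp c := Real.one_le_exp ((abs_nonneg u).trans hu)
  rcases le_total |u| 1 with hsmall | hlarge
  · have := (abs_le.1 (Real.abs_exp_sub_one_sub_id_le hsmall)).2
    nlinarith [sq_nonneg u]
  · have hsq : 1 ≤ u ^ 2 := by
      rw [← sq_abs]
      exact one_le_pow₀ hlarge
    rcases le_total 0 u with hpos | hneg
    · have : Real.exp u ≤ Real.exp c := Real.exp_le_exp.2 ((le_abs_self u).trans hu)
      nlinarith
    · rw [abs_of_nonpos hneg] at hlarge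
      have : Real.exp u ≤ 1 := Real.exp_le_one_iff.2 hneg
      nlinarith

namespace SublinearExpectation

section StoppedProduct

variable {Ω : Type*} {t : ℝ} {ξ : ℕ → Ω → ℝ} {m j : ℕ} {ω : Ω}

/-- The process `∏_{i ≤ m} ξᵢ`, frozen at the first time it exceeds `t`. -/
def stoppedProd (t : ℝ) (ξ : ℕ → Ω → ℝ) : ℕ → Ω → ℝ
  | 0, _ => 1
  | m + 1, ω =>
    if t < stoppedProd t ξ m ω then stoppedProd t ξ m ω else stoppedProd t ξ m ω * ξ (m + 1) ω

theorem stoppedProd_nonneg (hξ : ∀ n ω, 0 ≤ ξ n ω) (m : ℕ) (ω : Ω) : 0 ≤ stoppedProd t ξ m ω := by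
  induction m with
  | zero => exact zero_le_one
  | succ m ih =>
    rw [stoppedProd]
    split_ifs
    exacts [ih, mul_nonneg ih (hξ _ _)]

theorem stoppedProd_le_of_succ_le (h : stoppedProd t ξ (m + 1) ω ≤ t) :
    stoppedProd t ξ m ω ≤ t := by
  by_contra! hlt
  rw [stoppedProd, if_pos hlt] at h
  exact h.not_gt hlt

theorem stoppedProd_le_of_le (hjm : j ≤ m) (h : stoppedProd t ξ m ω ≤ t) :
    stoppedProd t ξ j ω ≤ t := by
  induction m, hjm using Nat.le_induction with
  | base => exact h
  | succ m _ ih => exact ih (stoppedProd_le_of_succ_le h)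

theorem stoppedProd_eq_prod (h : stoppedProd t ξ m ω ≤ t) :
    stoppedProd t ξ m ω = ∏ i ∈ Finset.Icc 1 m, ξ i ω := by
  induction m with
  | zero => simp [stoppedProd]
  | succ m ih =>
    have hm := stoppedProd_le_of_succ_le h
    rw [stoppedProd, if_neg hm.not_gt, ih hm, Finset.prod_Icc_succ_top (Nat.succ_pos m)]

theorem lt_stoppedProd (hjm : j ≤ m) (h : t < ∏ i ∈ Finset.Icc 1 j, ξ i ω) :
    t < stoppedProd t ξ m ω := by
  by_contra! hm
  have hj := stoppedProd_le_of_le hjm hm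
  exact h.not_ge (stoppedProd_eq_prod hj ▸ hj)

theorem stoppedProd_succ_eq_indicator :
    stoppedProd t ξ (m + 1) = fun ω =>
      {ω | t < stoppedProd t ξ m ω}.indicator (stoppedProd t ξ m) ω +
        {ω | t < stoppedProd t ξ m ω}ᶜ.indicator (stoppedProd t ξ m) ω * ξ (m + 1) ω := by
  funext ω
  rw [stoppedProd]
  split_ifs with h <;> simp [h]

theorem measurable_past_stoppedProd {X : ℕ → Ω → ℝ} {ξ : ℕ → ℝ → ℝ} (hξ : ∀ n, Measurable (ξ n))
    (m : ℕ) : Measurable[past X m] (stoppedProd t (fun n ω => ξ n (X n ω)) m) := by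
  induction m with
  | zero => exact measurable_const
  | succ m ih =>
    have hm := ih.mono past_le_succ le_rfl
    exact Measurable.ite (measurableSet_lt measurable_const hm) hm
      (hm.mul ((hξ _).comp (measurable_past (Nat.succ_pos m))))

end StoppedProduct

variable {Ω : Type*} [MeasurableSpace Ω] {S : SublinearExpectation Ω} {X : ℕ → Ω → ℝ}

theorem isBdd_stoppedProd (hX : ∀ n, 1 ≤ n → X n ∈ S.H) {ξ : ℕ → ℝ → ℝ}
    (hξ : ∀ n, Measurable (ξ n)) (hb : ∀ n, 1 ≤ n → S.IsBdd (fun ω => ξ n (X n ω))) (t : ℝ)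
    (m : ℕ) : S.IsBdd (stoppedProd t (fun n ω => ξ n (X n ω)) m) := by
  induction m with
  | zero => exact isBdd_const 1
  | succ m ih =>
    have hA : MeasurableSet {ω | t < stoppedProd t (fun n ω => ξ n (X n ω)) m ω} :=
      measurableSet_lt measurable_const
        ((measurable_past_stoppedProd hξ m).mono (past_le hX) le_rfl)
    rw [stoppedProd_succ_eq_indicator]
    exact (ih.indicator hA).add ((ih.indicator hA.compl).mul (hb _ (Nat.succ_pos m)))

theorem IndepSeq.ev_stoppedProd_le_one (hind : S.IndepSeq X) (hX : ∀ n, 1 ≤ n → X n ∈ S.H)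
    {ξ : ℕ → ℝ → ℝ} (hξ : ∀ n, Measurable (ξ n)) (hξ0 : ∀ n y, 0 ≤ ξ n y)
    (hb : ∀ n, 1 ≤ n → S.IsBdd (fun ω => ξ n (X n ω)))
    (he : ∀ n, 1 ≤ n → S.ev (fun ω => ξ n (X n ω)) ≤ 1) (t : ℝ) (m : ℕ) :
    S.ev (stoppedProd t (fun n ω => ξ n (X n ω)) m) ≤ 1 := by
  induction m with
  | zero => exact (ev_const 1).le
  | succ m ih =>
    set M := stoppedProd t (fun n ω => ξ n (X n ω)) m
    set A : Set Ω := {ω | t < M ω}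
    have hm : 1 ≤ m + 1 := Nat.succ_pos m
    have hM0 : ∀ ω, 0 ≤ M ω := stoppedProd_nonneg (fun n ω => hξ0 n (X n ω)) m
    have hMm : Measurable[past X m] M := measurable_past_stoppedProd hξ m
    have hA : MeasurableSet[past X m] A := measurableSet_lt measurable_const hMm
    have hAΩ : MeasurableSet A := past_le hX A hA
    have hMb : S.IsBdd M := isBdd_stoppedProd hX hξ hb t m
    rw [stoppedProd_succ_eq_indicator,
      hind.ev_add_mul (hMm.indicator hA) (hMm.indicator hA.compl) (hξ (m + 1))
        (hMb.indicator hAΩ) (hMb.indicator hAΩ.compl) (hb _ hm)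
        (Set.indicator_nonneg fun ω _ => hM0 ω) (Set.indicator_nonneg fun ω _ => hM0 ω) (hξ0 _)]
    refine (ev_mono ((hMb.indicator hAΩ).add ((hMb.indicator hAΩ.compl).mul (isBdd_const _))) hMb
      fun ω => ?_).trans ih
    calc A.indicator M ω + Aᶜ.indicator M ω * S.ev (fun ω' => ξ (m + 1) (X (m + 1) ω'))
        ≤ A.indicator M ω + Aᶜ.indicator M ω :=
          add_le_add_right (mul_le_of_le_one_right
            (Set.indicator_nonneg (fun ω _ => hM0 ω) ω) (he _ hm)) _
      _ = M ω := congrFun (Set.indicator_self_add_compl A M) ω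

/-- Ville's maximal inequality. -/
theorem IndepSeq.capacity_exists_lt_prod_le (hind : S.IndepSeq X) (hX : ∀ n, 1 ≤ n → X n ∈ S.H)
    {ξ : ℕ → ℝ → ℝ} (hξ : ∀ n, Measurable (ξ n)) (hξ0 : ∀ n y, 0 ≤ ξ n y)
    (hb : ∀ n, 1 ≤ n → S.IsBdd (fun ω => ξ n (X n ω)))
    (he : ∀ n, 1 ≤ n → S.ev (fun ω => ξ n (X n ω)) ≤ 1) {t : ℝ} (ht : 0 < t) (m : ℕ) :
    S.capacity {ω | ∃ j ≤ m, t < ∏ i ∈ Finset.Icc 1 j, ξ i (X i ω)} ≤ ENNReal.ofReal (1 / t) := by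
  have hmeas : MeasurableSet {ω | ∃ j ≤ m, t < ∏ i ∈ Finset.Icc 1 j, ξ i (X i ω)} :=
    measurableSet_exists_le_lt (fun j => Finset.measurable_fun_prod _ fun i hi =>
      (hξ i).comp (S.measurable_of_mem _ (hX _ (Finset.mem_Icc.1 hi).1))) m t
  calc S.capacity {ω | ∃ j ≤ m, t < ∏ i ∈ Finset.Icc 1 j, ξ i (X i ω)}
      ≤ ENNReal.ofReal (S.ev (stoppedProd t (fun n ω => ξ n (X n ω)) m) / t) := by
        refine capacity_le_ofReal_ev_div hmeas (isBdd_stoppedProd hX hξ hb t m)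
          (stoppedProd_nonneg (fun n ω => hξ0 n (X n ω)) m) ht ?_
        rintro ω ⟨j, hj, hlt⟩
        exact (lt_stoppedProd hj hlt).le
    _ ≤ ENNReal.ofReal (1 / t) := by
        gcongr
        exact hind.ev_stoppedProd_le_one hX hξ hξ0 hb he t m

/-- Chernoff's method: the majorants `q i` of `exp (l Zᵢ)` stand in for the exponentials, which
need not belong to `H`. -/
theorem IndepSeq.capacity_exists_lt_sum_le_exp (hind : S.IndepSeq X)
    (hX : ∀ n, 1 ≤ n → X n ∈ S.H) {Z q : ℕ → ℝ → ℝ} {l : ℝ} (hl : 0 < l) {κ : ℕ → ℝ}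
    (hκ : ∀ n, 0 ≤ κ n) (hq : ∀ n, Measurable (q n)) (hZq : ∀ n y, Real.exp (l * Z n y) ≤ q n y)
    (hqb : ∀ n, 1 ≤ n → S.IsBdd (fun ω => q n (X n ω)))
    (hqe : ∀ n, 1 ≤ n → S.ev (fun ω => q n (X n ω)) ≤ Real.exp (κ n)) (ε : ℝ) (m : ℕ) :
    S.capacity {ω | ∃ j ≤ m, ε < ∑ i ∈ Finset.Icc 1 j, Z i (X i ω)} ≤
      ENNReal.ofReal (Real.exp (-l * ε + ∑ i ∈ Finset.Icc 1 m, κ i)) := by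
  set K := ∑ i ∈ Finset.Icc 1 m, κ i
  set ξ : ℕ → ℝ → ℝ := fun i y => Real.exp (-κ i) * q i y
  have hZξ (i y) : Real.exp (l * Z i y - κ i) ≤ ξ i y := by
    rw [sub_eq_neg_add, Real.exp_add]
    exact mul_le_mul_of_nonneg_left (hZq i y) (Real.exp_pos _).le
  have hξe (n) (hn : 1 ≤ n) : S.ev (fun ω => ξ n (X n ω)) ≤ 1 := by
    rw [ev_const_mul (hqb n hn) (Real.exp_pos _).le]
    calc Real.exp (-κ n) * S.ev (fun ω => q n (X n ω))
        ≤ Real.exp (-κ n) * Real.exp (κ n) :=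
          mul_le_mul_of_nonneg_left (hqe n hn) (Real.exp_pos _).le
      _ = 1 := by rw [← Real.exp_add, neg_add_cancel, Real.exp_zero]
  have hville := hind.capacity_exists_lt_prod_le hX (fun n => (hq n).const_mul _)
    (fun n y => (Real.exp_pos _).le.trans (hZξ n y))
    (fun n hn => (isBdd_const _).mul (hqb n hn)) hξe (Real.exp_pos (l * ε - K)) m
  rw [one_div, ← Real.exp_neg, neg_sub', sub_neg_eq_add, ← neg_mul] at hville
  refine (capacity_mono ?_).trans hville
  rintro ω ⟨j, hj, hlt⟩
  refine ⟨j, hj, ?_⟩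
  have hκle : ∑ i ∈ Finset.Icc 1 j, κ i ≤ K :=
    Finset.sum_le_sum_of_subset_of_nonneg (Finset.Icc_subset_Icc_right hj) fun i _ _ => hκ i
  calc Real.exp (l * ε - K) < Real.exp (∑ i ∈ Finset.Icc 1 j, (l * Z i (X i ω) - κ i)) := by
        rw [Real.exp_lt_exp, Finset.sum_sub_distrib, ← Finset.mul_sum]
        linarith [mul_lt_mul_of_pos_left hlt hl]
    _ ≤ ∏ i ∈ Finset.Icc 1 j, ξ i (X i ω) := by
        rw [Real.exp_sum]
        exact Finset.prod_le_prod (fun i _ => (Real.exp_pos _).le) fun i _ => hZξ i _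

/-- Bernstein's inequality in maximal form. -/
theorem IndepSeq.capacity_exists_lt_sum_le (hind : S.IndepSeq X)
    (hX : ∀ n, 1 ≤ n → X n ∈ S.H) {Z : ℕ → ℝ → ℝ} (hZ : ∀ n, Measurable (Z n)) {d : ℝ}
    (hd : ∀ n y, |Z n y| ≤ d) (hZX : ∀ n, 1 ≤ n → (fun ω => Z n (X n ω)) ∈ S.H)
    {μ σ : ℕ → ℝ} (hμ : ∀ n, 1 ≤ n → S.ev (fun ω => Z n (X n ω)) ≤ μ n)
    (hσ : ∀ n, 1 ≤ n → S.ev (fun ω => Z n (X n ω) ^ 2) ≤ σ n)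
    (hμ0 : ∀ n, 0 ≤ μ n) (hσ0 : ∀ n, 0 ≤ σ n) {l : ℝ} (hl : 0 < l) (ε : ℝ) (m : ℕ) :
    S.capacity {ω | ∃ j ≤ m, ε < ∑ i ∈ Finset.Icc 1 j, Z i (X i ω)} ≤
      ENNReal.ofReal (Real.exp (-l * ε + (l * ∑ i ∈ Finset.Icc 1 m, μ i +
        l ^ 2 * Real.exp (l * d) * ∑ i ∈ Finset.Icc 1 m, σ i))) := by
  set L := l ^ 2 * Real.exp (l * d)
  have hL : 0 ≤ L := by positivity
  have hquad (i y) : Real.exp (l * Z i y) ≤ 1 + (l * Z i y + L * Z i y ^ 2) := by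
    have hle := exp_le_one_add_add_sq (u := l * Z i y) (c := l * d) (by
      rw [abs_mul, abs_of_pos hl]
      exact mul_le_mul_of_nonneg_left (hd i y) hl.le)
    linarith [show L * Z i y ^ 2 = Real.exp (l * d) * (l * Z i y) ^ 2 by ring]
  have hZb (n) (hn : 1 ≤ n) : S.IsBdd (fun ω => Z n (X n ω)) := ⟨hZX n hn, d, fun ω => hd n _⟩
  have hZ2b (n) (hn : 1 ≤ n) : S.IsBdd (fun ω => Z n (X n ω) ^ 2) := by
    simpa only [sq] using (hZb n hn).mul (hZb n hn)
  have hlin (n) (hn : 1 ≤ n) : S.IsBdd (fun ω => l * Z n (X n ω)) := (isBdd_const l).mul (hZb n hn)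
  have hsq (n) (hn : 1 ≤ n) : S.IsBdd (fun ω => L * Z n (X n ω) ^ 2) :=
    (isBdd_const L).mul (hZ2b n hn)
  have hev (n) (hn : 1 ≤ n) : S.ev (fun ω => 1 + (l * Z n (X n ω) + L * Z n (X n ω) ^ 2)) ≤
      Real.exp (l * μ n + L * σ n) := by
    rw [ev_const_add ((hlin n hn).add (hsq n hn))]
    calc 1 + S.ev (fun ω => l * Z n (X n ω) + L * Z n (X n ω) ^ 2)
        ≤ 1 + (l * S.ev (fun ω => Z n (X n ω)) + L * S.ev (fun ω => Z n (X n ω) ^ 2)) := by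
          rw [← ev_const_mul (hZb n hn) hl.le, ← ev_const_mul (hZ2b n hn) hL]
          exact add_le_add le_rfl (ev_add_le (hlin n hn) (hsq n hn))
      _ ≤ l * μ n + L * σ n + 1 := by
          rw [add_comm (1 : ℝ)]
          gcongr
          exacts [hμ n hn, hσ n hn]
      _ ≤ Real.exp (l * μ n + L * σ n) := Real.add_one_le_exp _
  rw [Finset.mul_sum, Finset.mul_sum, ← Finset.sum_add_distrib]
  exact hind.capacity_exists_lt_sum_le_exp hX hl
    (fun n => add_nonneg (mul_nonneg hl.le (hμ0 n)) (mul_nonneg hL (hσ0 n)))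
    (fun n => by have := hZ n; fun_prop) hquad
    (fun n hn => (isBdd_const 1).add ((hlin n hn).add (hsq n hn))) hev ε m

end SublinearExpectation

end

/-! ### Integration over levels -/

section

open MeasureTheory Filter

theorem volume_setOf_ofReal_lt_inter_Ioo {v : ℝ≥0∞} (hv : v ≤ 1) :
    volume ({s : ℝ | ENNReal.ofReal s < v} ∩ Set.Ioo 0 1) = v := by
  have hv_top : v ≠ ⊤ := (hv.trans_lt ENNReal.one_lt_top).ne
  have hset : {s : ℝ | ENNReal.ofReal s < v} ∩ Set.Ioo 0 1 = Set.Ioo 0 v.toReal := by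
    ext s
    simp only [Set.mem_inter_iff, Set.mem_ofPred_eq, Set.mem_Ioo]
    constructor
    · rintro ⟨hlt, hpos, -⟩
      exact ⟨hpos, (ENNReal.ofReal_lt_iff_lt_toReal hpos.le hv_top).1 hlt⟩
    · rintro ⟨hpos, hlt⟩
      exact ⟨(ENNReal.ofReal_lt_iff_lt_toReal hpos.le hv_top).2 hlt, hpos,
        hlt.trans_le (ENNReal.toReal_le_of_le_ofReal zero_le_one (by simpa using hv))⟩
  rw [hset, Real.volume_Ioo, sub_zero, ENNReal.ofReal_toReal hv_top]

theorem measurable_ite_ofReal_lt (v c : ℝ≥0∞) :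
    Measurable fun s : ℝ => if ENNReal.ofReal s < v then c else 0 :=
  Measurable.ite (measurableSet_lt ENNReal.measurable_ofReal measurable_const)
    measurable_const measurable_const

theorem lintegral_Ioo_ite_ofReal_lt {v : ℝ≥0∞} (hv : v ≤ 1) (c : ℝ≥0∞) :
    ∫⁻ s in Set.Ioo (0 : ℝ) 1, (if ENNReal.ofReal s < v then c else 0) = c * v := by
  have hmeas : MeasurableSet {s : ℝ | ENNReal.ofReal s < v} :=
    measurableSet_lt ENNReal.measurable_ofReal measurable_const
  have hind : (fun s : ℝ => if ENNReal.ofReal s < v then c else 0) =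
      {s : ℝ | ENNReal.ofReal s < v}.indicator fun _ => c := by
    funext s
    simp [Set.indicator_apply]
  rw [hind, lintegral_indicator_const hmeas, Measure.restrict_apply hmeas,
    volume_setOf_ofReal_lt_inter_Ioo hv]

theorem tsum_mul_eq_lintegral_tsum_ite {ι : Type*} [Countable ι] (w : ι → ℝ≥0∞) {v : ι → ℝ≥0∞}
    (hv : ∀ i, v i ≤ 1) :
    ∑' i, w i * v i =
      ∫⁻ s in Set.Ioo (0 : ℝ) 1, ∑' i, if ENNReal.ofReal s < v i then w i else 0 := by
  rw [lintegral_tsum fun i => (measurable_ite_ofReal_lt (v i) (w i)).aemeasurable]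
  exact tsum_congr fun i => (lintegral_Ioo_ite_ofReal_lt (hv i) (w i)).symm

theorem lintegral_Ioi_eq_lintegral_volume {G : ℝ → ℝ≥0∞} (hG : Measurable G)
    (hG1 : ∀ y, G y ≤ 1) :
    ∫⁻ y in Set.Ioi (0 : ℝ), G y =
      ∫⁻ s in Set.Ioo (0 : ℝ) 1, volume ({y | ENNReal.ofReal s < G y} ∩ Set.Ioi 0) := by
  have hlevel (y) : G y = ∫⁻ s in Set.Ioo (0 : ℝ) 1, if ENNReal.ofReal s < G y then 1 else 0 := by
    rw [lintegral_Ioo_ite_ofReal_lt (hG1 y), one_mul]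
  have hjoint : Measurable fun q : ℝ × ℝ =>
      if ENNReal.ofReal q.2 < G q.1 then (1 : ℝ≥0∞) else 0 :=
    Measurable.ite (measurableSet_lt (ENNReal.measurable_ofReal.comp measurable_snd)
      (hG.comp measurable_fst)) measurable_const measurable_const
  conv_lhs => enter [2, y]; rw [hlevel]
  rw [lintegral_lintegral_swap hjoint.aemeasurable]
  refine lintegral_congr fun s => ?_
  have hmeas : MeasurableSet {y : ℝ | ENNReal.ofReal s < G y} :=
    measurableSet_lt measurable_const hG
  rw [← Measure.restrict_apply hmeas, ← lintegral_indicator_one hmeas]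
  refine lintegral_congr fun y => ?_
  simp [Set.indicator_apply]

theorem lintegral_Ioo_const_mul_add_const {C : ℝ≥0∞} (hC : C ≠ ⊤) (C' : ℝ≥0∞) (f : ℝ → ℝ≥0∞) :
    ∫⁻ s in Set.Ioo (0 : ℝ) 1, (C * f s + C') = C * (∫⁻ s in Set.Ioo (0 : ℝ) 1, f s) + C' := by
  rw [lintegral_add_right _ measurable_const, lintegral_const_mul' _ _ hC]
  simp

theorem tsum_ite_natCast_le (T : ℝ) (hT : 0 ≤ T) :
    ∑' k : ℕ, (if (k : ℝ) ≤ T then (1 : ℝ≥0∞) else 0) ≤ ENNReal.ofReal T + 1 := by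
  have hsupp (k : ℕ) (hk : k ∉ Finset.range (⌊T⌋₊ + 1)) :
      (if (k : ℝ) ≤ T then (1 : ℝ≥0∞) else 0) = 0 :=
    if_neg fun hkT => hk (Finset.mem_range.2 (Nat.lt_succ_of_le (Nat.le_floor hkT)))
  rw [tsum_eq_sum hsupp]
  calc ∑ k ∈ Finset.range (⌊T⌋₊ + 1), (if (k : ℝ) ≤ T then (1 : ℝ≥0∞) else 0)
      ≤ ∑ _k ∈ Finset.range (⌊T⌋₊ + 1), 1 := Finset.sum_le_sum fun k _ => by split_ifs <;> simp
    _ = ENNReal.ofReal (⌊T⌋₊ : ℝ) + 1 := by simp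
    _ ≤ ENNReal.ofReal T + 1 := by gcongr; exact Nat.floor_le hT

namespace SublinearExpectation

variable {Ω : Type*} [MeasurableSpace Ω] {S : SublinearExpectation Ω}

theorem antitone_capacity_lt (Y : Ω → ℝ) : Antitone fun y => S.capacity {ω | y < Y ω} :=
  fun _ _ hxy => capacity_mono fun _ hω => lt_of_le_of_lt hxy hω

/-- Both sides are integrated over the levels `s` of the capacity: on the left the indices `i` with
`s < V(Y > xᵢ)` have `xᵢ` below a largest one, on the right `y` runs over an interval. -/
theorem tsum_mul_capacity_le_lintegral {ι : Type*} [Countable ι] {w : ι → ℝ≥0∞} {x : ι → ℝ}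
    (hx : ∀ i, 0 ≤ x i) {h : ℝ → ℝ} (hh : MonotoneOn h (Set.Ici 0)) {C C' : ℝ≥0∞} (hC : C ≠ ⊤)
    (hw : ∀ T, 0 ≤ T → ∑' i, (if x i ≤ T then w i else 0) ≤ C * ENNReal.ofReal (h T) + C')
    (Y : Ω → ℝ) :
    ∑' i, w i * S.capacity {ω | x i < Y ω} ≤
      C * (∫⁻ y in Set.Ioi (0 : ℝ), S.capacity {ω | y < h (Y ω)}) + C' := by
  rw [tsum_mul_eq_lintegral_tsum_ite _ fun i => S.capacity_le_one _,
    lintegral_Ioi_eq_lintegral_volume (antitone_capacity_lt _).measurable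
      fun i => S.capacity_le_one _, ← lintegral_Ioo_const_mul_add_const hC]
  refine lintegral_mono fun s => ?_
  rw [ENNReal.tsum_eq_iSup_sum]
  refine iSup_le fun t => ?_
  rw [← Finset.sum_filter]
  set u := t.filter fun i => ENNReal.ofReal s < S.capacity {ω | x i < Y ω}
  rcases u.eq_empty_or_nonempty with hempty | hne
  · rw [hempty, Finset.sum_empty]
    exact zero_le
  obtain ⟨k, hk, hmax⟩ := u.exists_max_image x hne
  have hlevel : ENNReal.ofReal s < S.capacity {ω | x k < Y ω} := (Finset.mem_filter.1 hk).2
  have hsub : Set.Ioo 0 (h (x k)) ⊆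
      {y | ENNReal.ofReal s < S.capacity {ω | y < h (Y ω)}} ∩ Set.Ioi 0 := fun y hy =>
    ⟨hlevel.trans_le (capacity_mono fun ω (hω : x k < Y ω) =>
      hy.2.trans_le (hh (hx k) ((hx k).trans hω.le) hω.le)), hy.1⟩
  calc ∑ i ∈ u, w i ≤ ∑ i ∈ u, (if x i ≤ x k then w i else 0) :=
        Finset.sum_le_sum fun i hi => by rw [if_pos (hmax i hi)]
    _ ≤ ∑' i, (if x i ≤ x k then w i else 0) := ENNReal.sum_le_tsum _
    _ ≤ C * ENNReal.ofReal (h (x k)) + C' := hw _ (hx k)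
    _ = C * volume (Set.Ioo 0 (h (x k))) + C' := by rw [Real.volume_Ioo, sub_zero]
    _ ≤ _ := by gcongr

theorem lintegral_le_tsum_mul_capacity {ι : Type*} [Countable ι] {w : ι → ℝ≥0∞} {x : ι → ℝ}
    {h : ℝ → ℝ} (hh : MonotoneOn h (Set.Ici 0)) (hcont : ContinuousOn h (Set.Ici 0))
    (h_zero : h 0 = 0) (hlim : Tendsto h atTop atTop) {C C' : ℝ≥0∞} (hC : C ≠ ⊤)
    (hw : ∀ T, 0 ≤ T → ENNReal.ofReal (h T) ≤ C * ∑' i, (if x i ≤ T then w i else 0) + C')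
    {Y : Ω → ℝ} (hY : ∀ ω, 0 ≤ Y ω) :
    ∫⁻ y in Set.Ioi (0 : ℝ), S.capacity {ω | y < h (Y ω)} ≤
      C * ∑' i, w i * S.capacity {ω | x i < Y ω} + C' := by
  rw [tsum_mul_eq_lintegral_tsum_ite _ fun i => S.capacity_le_one _,
    lintegral_Ioi_eq_lintegral_volume (antitone_capacity_lt _).measurable
      fun i => S.capacity_le_one _, ← lintegral_Ioo_const_mul_add_const hC]
  refine lintegral_mono fun s => ?_
  set M := C * ∑' i, (if ENNReal.ofReal s < S.capacity {ω | x i < Y ω} then w i else 0) + C'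
  rcases eq_or_ne M ⊤ with hM | hM
  · exact le_top.trans_eq hM.symm
  have hsub : {y | ENNReal.ofReal s < S.capacity {ω | y < h (Y ω)}} ∩ Set.Ioi 0 ⊆
      Set.Ioc 0 M.toReal := by
    rintro _ ⟨hlevel, hpos⟩
    refine ⟨hpos, ?_⟩
    obtain ⟨b, hb, hyb⟩ := ((eventually_ge_atTop (0 : ℝ)).and (hlim.eventually_ge_atTop _)).exists
    obtain ⟨T, ⟨hT, -⟩, rfl⟩ := intermediate_value_Icc hb (hcont.mono Set.Icc_subset_Ici_self)
      ⟨h_zero.le.trans (le_of_lt hpos), hyb⟩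
    have himp (i) (hi : x i ≤ T) : ENNReal.ofReal s < S.capacity {ω | x i < Y ω} :=
      hlevel.trans_le (capacity_mono fun ω (hω : h T < h (Y ω)) =>
        hi.trans_lt (hh.reflect_lt hT (hY ω) hω))
    rw [← ENNReal.ofReal_le_iff_le_toReal hM]
    refine (hw T hT).trans (add_le_add_left (mul_le_mul_right ?_ C) C')
    refine ENNReal.tsum_le_tsum fun i => ?_
    split_ifs with hi hs hs
    exacts [le_rfl, absurd (himp i hi) hs, zero_le, le_rfl]
  calc _ ≤ volume (Set.Ioc 0 M.toReal) := measure_mono hsub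
    _ = M := by rw [Real.volume_Ioc, sub_zero, ENNReal.ofReal_toReal hM]

theorem tsum_capacity_natCast_lt_le (Y : Ω → ℝ) :
    ∑' k : ℕ, S.capacity {ω | (k : ℝ) < Y ω} ≤
      (∫⁻ y in Set.Ioi (0 : ℝ), S.capacity {ω | y < Y ω}) + 1 := by
  simpa using tsum_mul_capacity_le_lintegral (S := S) (w := fun _ => 1) Nat.cast_nonneg
    (monotoneOn_id (s := Set.Ici (0 : ℝ))) ENNReal.one_ne_top (C' := 1)
    (fun T hT => by simpa using tsum_ite_natCast_le T hT) Y

theorem CountablySubadditive.toENNReal_E_le_tsum_capacity (hS : S.CountablySubadditive)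
    {ξ : Ω → ℝ} (hξ : ξ ∈ S.H) (h0 : ∀ ω, 0 ≤ ξ ω) :
    (S.E ξ).toENNReal ≤ ∑' k : ℕ, S.capacity {ω | (k : ℝ) < ξ ω} := by
  have hmeas (k : ℕ) : MeasurableSet {ω | (k : ℝ) < ξ ω} :=
    measurableSet_lt measurable_const (S.measurable_of_mem _ hξ)
  have hE (k : ℕ) : (S.E ({ω | (k : ℝ) < ξ ω}.indicator fun _ => 1)).toENNReal =
      S.capacity {ω | (k : ℝ) < ξ ω} := by
    rw [capacity_eq_ofReal_ev (hmeas k), ← (isBdd_indicator_one (hmeas k)).coe_ev,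
      EReal.toENNReal_of_ne_top (EReal.coe_ne_top _), EReal.toReal_coe]
  refine (hS ξ (fun k : ℕ => {ω | (k : ℝ) < ξ ω}.indicator fun _ => 1) hξ
    (fun k => S.indicator_mem _ (hmeas k)) h0
    (fun k => Set.indicator_nonneg fun _ _ => zero_le_one) fun ω => ?_).trans_eq (tsum_congr hE)
  calc ENNReal.ofReal (ξ ω) ≤ ENNReal.ofReal (⌈ξ ω⌉₊ : ℝ) := by gcongr; exact Nat.le_ceil _
    _ = ∑ k ∈ Finset.range ⌈ξ ω⌉₊,
          ENNReal.ofReal ({ω | (k : ℝ) < ξ ω}.indicator (fun _ => 1) ω) := by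
        rw [Finset.sum_congr rfl (g := fun _ => (1 : ℝ≥0∞)) fun k hk => ?_]
        · simp
        · have : (k : ℝ) < ξ ω := Nat.lt_ceil.1 (Finset.mem_range.1 hk)
          simp [this]
    _ ≤ _ := ENNReal.sum_le_tsum _

theorem CountablySubadditive.exists_E_le (hS : S.CountablySubadditive) {Y : Ω → ℝ}
    (hY : ∫⁻ y in Set.Ioi (0 : ℝ), S.capacity {ω | y < Y ω} < ⊤) :
    ∃ D : ℝ, 0 ≤ D ∧ ∀ ξ ∈ S.H, (∀ ω, 0 ≤ ξ ω) → ∀ K : ℝ, 0 < K → (∀ ω, ξ ω ≤ K * (1 + Y ω)) →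
      S.E ξ ≤ ((K * D : ℝ) : EReal) := by
  set I := ∫⁻ y in Set.Ioi (0 : ℝ), S.capacity {ω | y < Y ω}
  have hI : 1 + (I + 1) ≠ ⊤ := by simp [hY.ne]
  refine ⟨(1 + (I + 1)).toReal, ENNReal.toReal_nonneg, fun ξ hξ hξ0 K hK hle => ?_⟩
  have hmem : (fun ω => K⁻¹ * ξ ω) ∈ S.H := S.const_mul_mem _ hξ
  have hscaled : (S.E fun ω => K⁻¹ * ξ ω).toENNReal ≤ 1 + (I + 1) := calc
    _ ≤ ∑' k : ℕ, S.capacity {ω | (k : ℝ) < K⁻¹ * ξ ω} :=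
        hS.toENNReal_E_le_tsum_capacity hmem fun ω => mul_nonneg (inv_nonneg.2 hK.le) (hξ0 ω)
    _ = S.capacity {ω | ((0 : ℕ) : ℝ) < K⁻¹ * ξ ω} +
          ∑' k : ℕ, S.capacity {ω | ((k + 1 : ℕ) : ℝ) < K⁻¹ * ξ ω} :=
        tsum_eq_zero_add' ENNReal.summable
    _ ≤ 1 + ∑' k : ℕ, S.capacity {ω | (k : ℝ) < Y ω} := by
        refine add_le_add (S.capacity_le_one _) (ENNReal.tsum_le_tsum fun k =>
          capacity_mono fun ω (hk : ((k + 1 : ℕ) : ℝ) < K⁻¹ * ξ ω) => ?_)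
        have := (inv_mul_le_iff₀ hK).2 (hle ω)
        push_cast at hk
        exact (by linarith : (k : ℝ) < Y ω)
    _ ≤ 1 + (I + 1) := by gcongr; exact tsum_capacity_natCast_lt_le Y
  have hreal : S.E (fun ω => K⁻¹ * ξ ω) ≤ (((1 + (I + 1)).toReal : ℝ) : EReal) := by
    rw [EReal.coe_ennreal_toReal hI]
    exact ((le_max_right _ _).trans_eq EReal.coe_toENNReal_eq_max.symm).trans
      (EReal.coe_ennreal_le_coe_ennreal_iff.2 hscaled)
  calc S.E ξ = S.E (fun ω => K * (K⁻¹ * ξ ω)) := by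
        congr! 2 with ω
        rw [mul_inv_cancel_left₀ hK.ne']
    _ = (K : EReal) * S.E (fun ω => K⁻¹ * ξ ω) := S.pos_homog _ hmem K hK.le
    _ ≤ ((K * (1 + (I + 1)).toReal : ℝ) : EReal) := by
        rw [EReal.coe_mul]
        exact mul_le_mul_of_nonneg_left hreal (by exact_mod_cast hK.le)

theorem choquet_lt_top_iff {Y : Ω → ℝ} (hY : ∀ ω, 0 ≤ Y ω) :
    S.choquet Y < ⊤ ↔ ∫⁻ y in Set.Ioi (0 : ℝ), S.capacity {ω | y < Y ω} < ⊤ := by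
  have hneg : ∫⁻ x in Set.Iio (0 : ℝ), (1 - S.capacity {ω | x < Y ω}) = 0 := by
    refine (setLIntegral_congr_fun measurableSet_Iio fun x hx => ?_).trans lintegral_zero
    have huniv : {ω | x < Y ω} = Set.univ :=
      Set.eq_univ_of_forall fun ω => lt_of_lt_of_le hx (hY ω)
    simp only [huniv, capacity_univ, tsub_self]
  rw [choquet, hneg]
  simp [lt_top_iff_ne_top]

end SublinearExpectation

end

/-! ### Counting thresholds -/

noncomputable section

open Finset

theorem sum_Icc_rpow_sub_one_le_rpow {γ : ℝ} (hγ : 1 ≤ γ) (M : ℕ) :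
    ∑ n ∈ Icc 1 M, (n : ℝ) ^ (γ - 1) ≤ (M : ℝ) ^ γ := by
  rcases M.eq_zero_or_pos with rfl | hM
  · simp [Real.zero_rpow (zero_lt_one.trans_le hγ).ne']
  have hM_pos : (0 : ℝ) < M := Nat.cast_pos.2 hM
  calc ∑ n ∈ Icc 1 M, (n : ℝ) ^ (γ - 1) ≤ ∑ _n ∈ Icc 1 M, (M : ℝ) ^ (γ - 1) :=
        sum_le_sum fun n hn => Real.rpow_le_rpow (Nat.cast_nonneg _)
          (Nat.cast_le.2 (mem_Icc.1 hn).2) (sub_nonneg.2 hγ)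
    _ = (M : ℝ) ^ γ := by
        rw [sum_const, Nat.card_Icc, nsmul_eq_mul, Nat.add_sub_cancel,
          Real.rpow_sub_one hM_pos.ne', mul_div_cancel₀ _ hM_pos.ne']

theorem mul_rpow_sub_one_le_rpow_sub_rpow {γ x : ℝ} (hγ : 0 ≤ γ) (hγ1 : γ ≤ 1) (hx : 1 ≤ x) :
    γ * x ^ (γ - 1) ≤ x ^ γ - (x - 1) ^ γ := by
  have hx0 : 0 < x := zero_lt_one.trans_le hx
  have hinv : x⁻¹ ≤ 1 := inv_le_one_of_one_le₀ hx
  have hbernoulli : (1 + -x⁻¹) ^ γ ≤ 1 + γ * -x⁻¹ :=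
    rpow_one_add_le_one_add_mul_self (neg_le_neg hinv) hγ hγ1
  calc γ * x ^ (γ - 1) = x ^ γ - (1 + γ * -x⁻¹) * x ^ γ := by
        rw [Real.rpow_sub_one hx0.ne']
        ring
    _ ≤ x ^ γ - (1 + -x⁻¹) ^ γ * x ^ γ := by gcongr
    _ = x ^ γ - (x - 1) ^ γ := by
        rw [← Real.mul_rpow (by linarith) hx0.le, add_mul, one_mul, neg_mul,
          inv_mul_cancel₀ hx0.ne', ← sub_eq_add_neg]

theorem mul_sum_Icc_rpow_sub_one_le_rpow {γ : ℝ} (hγ : 0 < γ) (hγ1 : γ ≤ 1) (M : ℕ) :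
    γ * ∑ n ∈ Icc 1 M, (n : ℝ) ^ (γ - 1) ≤ (M : ℝ) ^ γ := by
  induction M with
  | zero => simp [Real.zero_rpow hγ.ne']
  | succ M ih =>
    have hstep := mul_rpow_sub_one_le_rpow_sub_rpow (x := ((M + 1 : ℕ) : ℝ)) hγ.le hγ1 (by simp)
    rw [Nat.cast_succ, add_sub_cancel_right] at hstep
    rw [sum_Icc_succ_top (Nat.succ_pos M), mul_add, Nat.cast_succ]
    linarith

theorem exists_sum_rpow_sub_one_le {γ : ℝ} (hγ : 0 < γ) :
    ∃ C : ℝ, 0 < C ∧ ∀ R : ℝ, 0 ≤ R → ∑ n ∈ Icc 1 ⌊R⌋₊, (n : ℝ) ^ (γ - 1) ≤ C * R ^ γ := by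
  suffices hnat : ∃ C : ℝ, 0 < C ∧ ∀ M : ℕ, ∑ n ∈ Icc 1 M, (n : ℝ) ^ (γ - 1) ≤ C * (M : ℝ) ^ γ by
    obtain ⟨C, hC, hsum⟩ := hnat
    refine ⟨C, hC, fun R hR => (hsum _).trans ?_⟩
    gcongr
    exact Nat.floor_le hR
  rcases le_total 1 γ with hγ1 | hγ1
  · exact ⟨1, one_pos, fun M => (sum_Icc_rpow_sub_one_le_rpow hγ1 M).trans_eq (one_mul _).symm⟩
  · exact ⟨γ⁻¹, inv_pos.2 hγ, fun M =>
      (le_inv_mul_iff₀ hγ).2 (mul_sum_Icc_rpow_sub_one_le_rpow hγ hγ1 M)⟩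

theorem exists_le_sum_Ioc_rpow (e : ℝ) :
    ∃ c : ℝ, 0 < c ∧ ∀ R : ℝ, 4 ≤ R →
      c * R ^ (e + 1) ≤ ∑ n ∈ Ioc ⌊R / 2⌋₊ ⌊R⌋₊, (n : ℝ) ^ e := by
  set c : ℝ := min 1 ((1 / 2) ^ e)
  refine ⟨c / 4, by positivity, fun R hR => ?_⟩
  have hR0 : 0 < R := by linarith
  have hterm (n) (hn : n ∈ Ioc ⌊R / 2⌋₊ ⌊R⌋₊) : c * R ^ e ≤ (n : ℝ) ^ e := by
    have hRn : R / 2 < n := (Nat.floor_lt (by positivity)).1 (mem_Ioc.1 hn).1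
    have hnR : (n : ℝ) ≤ R := (Nat.le_floor_iff hR0.le).1 (mem_Ioc.1 hn).2
    rcases le_total 0 e with he | he
    · calc c * R ^ e ≤ (1 / 2) ^ e * R ^ e := by gcongr; exact min_le_right _ _
        _ = (R / 2) ^ e := by rw [← Real.mul_rpow (by norm_num) hR0.le, one_div_mul_eq_div]
        _ ≤ (n : ℝ) ^ e := Real.rpow_le_rpow (by positivity) hRn.le he
    · calc c * R ^ e ≤ 1 * R ^ e := by gcongr; exact min_le_left _ _
        _ = R ^ e := one_mul _
        _ ≤ (n : ℝ) ^ e := Real.rpow_le_rpow_of_nonpos (by linarith) hnR he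
  have hcard : R / 4 ≤ ((Ioc ⌊R / 2⌋₊ ⌊R⌋₊).card : ℝ) := by
    rw [Nat.card_Ioc, Nat.cast_sub (Nat.floor_le_floor (by linarith))]
    linarith [Nat.lt_floor_add_one R, Nat.floor_le (half_pos hR0).le]
  calc c / 4 * R ^ (e + 1) = R / 4 * (c * R ^ e) := by rw [Real.rpow_add_one hR0.ne']; ring
    _ ≤ ((Ioc ⌊R / 2⌋₊ ⌊R⌋₊).card : ℝ) * (c * R ^ e) := by gcongr
    _ = ∑ _n ∈ Ioc ⌊R / 2⌋₊ ⌊R⌋₊, c * R ^ e := by rw [sum_const, nsmul_eq_mul]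
    _ ≤ ∑ n ∈ Ioc ⌊R / 2⌋₊ ⌊R⌋₊, (n : ℝ) ^ e := sum_le_sum hterm

/-- The level `δ n^α k^{-β}` that `|X|` has to exceed at the pair `z = (k, n)`. -/
def threshold (α β δ : ℝ) (z : ℕ × ℕ) : ℝ := δ * ((z.2 : ℝ) ^ α * (z.1 : ℝ) ^ (-β))

/-- The weight `n^{r-2}` of the pair `(k, n)` if `1 ≤ k < n`; all other pairs have weight `0`. -/
def pairWeight (r : ℝ) (z : ℕ × ℕ) : ℝ≥0∞ :=
  if 1 ≤ z.1 ∧ z.1 < z.2 then ENNReal.ofReal ((z.2 : ℝ) ^ (r - 2)) else 0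

/-- The total weight of the pairs whose threshold is at most `T`. -/
def thresholdCount (r α β δ T : ℝ) : ℝ≥0∞ :=
  ∑' z : ℕ × ℕ, if threshold α β δ z ≤ T then pairWeight r z else 0

/-- The largest real `n` such that `n^α k^{-β} ≤ U`. -/
def cutoff (α β U : ℝ) (k : ℕ) : ℝ := (U * (k : ℝ) ^ β) ^ α⁻¹

/-- The order of magnitude `U^τ ∑_{1 ≤ k ≤ R} k^{β τ}`, `τ = (r - 1) / (p + β)`, of the threshold
count at `T = U δ`, where `R` is of the order `U^{1/p}`. -/
def countBound (r p β U R : ℝ) : ℝ :=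
  U ^ ((r - 1) / (p + β)) * ∑ k ∈ Icc 1 ⌊R⌋₊, (k : ℝ) ^ (β * ((r - 1) / (p + β)))

section Cutoff

variable {α β p r δ T U : ℝ} {k : ℕ}

theorem threshold_nonneg (hδ : 0 ≤ δ) (z : ℕ × ℕ) : 0 ≤ threshold α β δ z := by
  rw [threshold]
  positivity

theorem cutoff_nonneg (hU : 0 ≤ U) : 0 ≤ cutoff α β U k := by
  rw [cutoff]
  positivity

theorem le_cutoff_iff (hα : 0 < α) (hU : 0 ≤ U) {x : ℝ} (hx : 0 ≤ x) :
    x ≤ cutoff α β U k ↔ x ^ α ≤ U * (k : ℝ) ^ β :=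
  Real.le_rpow_inv_iff_of_pos hx (by positivity) hα

theorem threshold_le_iff (hα : 0 < α) (hδ : 0 < δ) (hT : 0 ≤ T) (hk : 1 ≤ k) (n : ℕ) :
    threshold α β δ (k, n) ≤ T ↔ n ≤ ⌊cutoff α β (T / δ) k⌋₊ := by
  have hkβ : 0 < (k : ℝ) ^ β := Real.rpow_pos_of_pos (Nat.cast_pos.2 hk) _
  rw [Nat.le_floor_iff (cutoff_nonneg (by positivity)),
    le_cutoff_iff hα (by positivity) n.cast_nonneg, threshold, ← le_div_iff₀' hδ,
    Real.rpow_neg k.cast_nonneg, ← div_eq_mul_inv, div_le_iff₀ hkβ]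

theorem mul_le_cutoff_iff (hp : 0 < p) (hα : 0 < p + β) (hU : 0 ≤ U) (hk : 1 ≤ k) {c : ℝ}
    (hc : 0 < c) :
    c * k ≤ cutoff (p + β) β U k ↔ (k : ℝ) ≤ U ^ p⁻¹ / c ^ ((p + β) / p) := by
  have hk0 : (0 : ℝ) < k := Nat.cast_pos.2 hk
  have hcp : (c ^ ((p + β) / p)) ^ p = c ^ (p + β) := by
    rw [← Real.rpow_mul hc.le, div_mul_cancel₀ _ hp.ne']
  calc c * k ≤ cutoff (p + β) β U k
      ↔ (c ^ (p + β) * (k : ℝ) ^ p) * (k : ℝ) ^ β ≤ U * (k : ℝ) ^ β := by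
        rw [le_cutoff_iff hα hU (by positivity), Real.mul_rpow hc.le hk0.le, Real.rpow_add hk0,
          ← mul_assoc]
    _ ↔ (k * c ^ ((p + β) / p)) ^ p ≤ U := by
        rw [mul_le_mul_iff_of_pos_right (Real.rpow_pos_of_pos hk0 β),
          Real.mul_rpow hk0.le (by positivity), hcp, mul_comm]
    _ ↔ (k : ℝ) ≤ U ^ p⁻¹ / c ^ ((p + β) / p) := by
        rw [le_div_iff₀ (by positivity), Real.le_rpow_inv_iff_of_pos (by positivity) hU hp]

theorem cutoff_rpow (hU : 0 ≤ U) (s : ℝ) :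
    cutoff α β U k ^ s = U ^ (s / α) * (k : ℝ) ^ (β * (s / α)) := by
  rw [cutoff, ← Real.rpow_mul (by positivity), Real.mul_rpow hU (by positivity),
    ← Real.rpow_mul k.cast_nonneg, inv_mul_eq_div]

theorem tsum_threshold_le_eq_sum_Ioc (hα : 0 < α) (hδ : 0 < δ) (hT : 0 ≤ T) (hk : 1 ≤ k) :
    ∑' n : ℕ, (if threshold α β δ (k, n) ≤ T then pairWeight r (k, n) else 0) =
      ENNReal.ofReal (∑ n ∈ Ioc k ⌊cutoff α β (T / δ) k⌋₊, (n : ℝ) ^ (r - 2)) := by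
  have hterm (n : ℕ) : (if threshold α β δ (k, n) ≤ T then pairWeight r (k, n) else 0) =
      if n ∈ Ioc k ⌊cutoff α β (T / δ) k⌋₊ then ENNReal.ofReal ((n : ℝ) ^ (r - 2)) else 0 := by
    simp only [threshold_le_iff hα hδ hT hk, pairWeight, hk, true_and, mem_Ioc, ← ite_and,
      and_comm]
  simp_rw [hterm]
  rw [ENNReal.ofReal_sum_of_nonneg fun n _ => by positivity,
    tsum_eq_sum (s := Ioc k ⌊cutoff α β (T / δ) k⌋₊) fun n hn => if_neg hn]
  exact sum_congr rfl fun n hn => if_pos hn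

theorem thresholdCount_eq_tsum :
    thresholdCount r α β δ T =
      ∑' k : ℕ, ∑' n : ℕ, if threshold α β δ (k, n) ≤ T then pairWeight r (k, n) else 0 :=
  ENNReal.tsum_prod (f := fun k n =>
    if threshold α β δ (k, n) ≤ T then pairWeight r (k, n) else 0)

end Cutoff

theorem mul_ofReal_countBound {r p β U : ℝ} (hU : 0 ≤ U) {C : ℝ} (hC : 0 ≤ C) (R : ℝ) :
    ENNReal.ofReal (C * countBound r p β U R) =
      ∑ k ∈ Icc 1 ⌊R⌋₊, ENNReal.ofReal (C * cutoff (p + β) β U k ^ (r - 1)) := by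
  rw [countBound, mul_sum, mul_sum, ENNReal.ofReal_sum_of_nonneg fun k _ => by positivity]
  simp_rw [cutoff_rpow hU]

theorem exists_thresholdCount_le {r p β : ℝ} (hr : 1 < r) (hp : 0 < p) (hα : 0 < p + β) :
    ∃ C : ℝ, 0 < C ∧ ∀ δ T : ℝ, 0 < δ → 0 ≤ T →
      thresholdCount r (p + β) β δ T ≤
        ENNReal.ofReal (C * countBound r p β (T / δ) ((T / δ) ^ p⁻¹)) := by
  obtain ⟨C, hC, hsum⟩ := exists_sum_rpow_sub_one_le (sub_pos.2 hr)
  refine ⟨C, hC, fun δ T hδ hT => ?_⟩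
  have hU : 0 ≤ T / δ := by positivity
  have hzero (k) (hk : k ∉ Icc 1 ⌊(T / δ) ^ p⁻¹⌋₊) : ∑' n : ℕ,
      (if threshold (p + β) β δ (k, n) ≤ T then pairWeight r (k, n) else 0) = 0 := by
    rcases k.eq_zero_or_pos with rfl | hk1
    · simp [pairWeight]
    · rw [tsum_threshold_le_eq_sum_Ioc hα hδ hT hk1, Ioc_eq_empty, sum_empty, ENNReal.ofReal_zero]
      refine fun hlt => hk (mem_Icc.2 ⟨hk1, Nat.le_floor ?_⟩)
      have hcut : (k : ℝ) ≤ cutoff (p + β) β (T / δ) k :=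
        (Nat.le_floor_iff (cutoff_nonneg hU)).1 hlt.le
      simpa using (mul_le_cutoff_iff hp hα hU hk1 one_pos).1 (by rwa [one_mul])
  rw [thresholdCount_eq_tsum, tsum_eq_sum hzero, mul_ofReal_countBound hU hC.le]
  refine sum_le_sum fun k hk => ?_
  rw [tsum_threshold_le_eq_sum_Ioc hα hδ hT (mem_Icc.1 hk).1]
  refine ENNReal.ofReal_le_ofReal (le_trans ?_ (hsum _ (cutoff_nonneg hU)))
  rw [sub_sub, one_add_one_eq_two]
  refine sum_le_sum_of_subset_of_nonneg (fun n hn => ?_) fun n _ _ => by positivity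
  rw [mem_Ioc] at hn
  exact mem_Icc.2 ⟨by lia, hn.2⟩

/-- For `k ≤ U^{1/p} / 4^{(p+β)/p}` the cutoff is at least `4 k`, so that all `n` between half the
cutoff and the cutoff are counted. -/
theorem exists_le_thresholdCount {r p β : ℝ} (hp : 0 < p) (hα : 0 < p + β) :
    ∃ c : ℝ, 0 < c ∧ ∀ δ T : ℝ, 0 < δ → 0 ≤ T →
      ENNReal.ofReal (c * countBound r p β (T / δ) ((T / δ) ^ p⁻¹ / 4 ^ ((p + β) / p))) ≤
        thresholdCount r (p + β) β δ T := by
  obtain ⟨c, hc, hsum⟩ := exists_le_sum_Ioc_rpow (r - 2)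
  refine ⟨c, hc, fun δ T hδ hT => ?_⟩
  have hU : 0 ≤ T / δ := by positivity
  rw [thresholdCount_eq_tsum, mul_ofReal_countBound hU hc.le]
  refine le_trans (sum_le_sum fun k hk => ?_) (ENNReal.sum_le_tsum _)
  obtain ⟨hk1, hkR⟩ := mem_Icc.1 hk
  rw [tsum_threshold_le_eq_sum_Ioc hα hδ hT hk1]
  refine ENNReal.ofReal_le_ofReal ?_
  set R := cutoff (p + β) β (T / δ) k
  have hkR4 : 4 * (k : ℝ) ≤ R := (mul_le_cutoff_iff hp hα hU hk1 (by norm_num)).2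
    ((Nat.le_floor_iff (by positivity)).1 hkR)
  have hk1' : (1 : ℝ) ≤ k := Nat.one_le_cast.2 hk1
  calc c * R ^ (r - 1) = c * R ^ (r - 2 + 1) := by ring_nf
    _ ≤ ∑ n ∈ Ioc ⌊R / 2⌋₊ ⌊R⌋₊, (n : ℝ) ^ (r - 2) := hsum R (by linarith)
    _ ≤ ∑ n ∈ Ioc k ⌊R⌋₊, (n : ℝ) ^ (r - 2) :=
        sum_le_sum_of_subset_of_nonneg
          (Ioc_subset_Ioc_left (Nat.le_floor (by linarith))) fun n _ _ => by positivity

end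

/-! ### Weights and the moment function -/

noncomputable section

open Finset Filter

theorem rpow_le_one_add_rpow {s t u : ℝ} (hs : 0 ≤ s) (hst : s ≤ t) (hu : 0 ≤ u) :
    u ^ s ≤ 1 + u ^ t := by
  rcases le_total u 1 with hu1 | hu1
  · exact (Real.rpow_le_one hu hu1 hs).trans (le_add_of_nonneg_right (by positivity))
  · exact (Real.rpow_le_rpow_of_exponent_le hu1 hst).trans (le_add_of_nonneg_left zero_le_one)

theorem rpow_le_one_add_mul_log {s t : ℝ} (hs : 0 ≤ s) (ht : 0 ≤ t) :
    t ^ s ≤ 1 + 2 * (t ^ s * Real.log (1 + t)) := by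
  have hlog : 0 ≤ Real.log (1 + t) := Real.log_nonneg (by linarith)
  have hpow : 0 ≤ t ^ s := by positivity
  rcases le_total t 1 with ht1 | ht1
  · linarith [Real.rpow_le_one ht ht1 hs, mul_nonneg hpow hlog]
  · have hlog2 : Real.log 2 ≤ Real.log (1 + t) := Real.log_le_log (by norm_num) (by linarith)
    nlinarith [Real.log_two_gt_d9]

theorem exists_sum_Ico_rpow_le {e m : ℝ} (hm : 0 < m) (hem : e + 1 ≤ m) :
    ∃ K : ℝ, ∀ n : ℕ, ∑ k ∈ Ico 1 n, (k : ℝ) ^ e ≤ K * (n : ℝ) ^ m := by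
  obtain ⟨K, -, hsum⟩ := exists_sum_rpow_sub_one_le hm
  refine ⟨K, fun n => ?_⟩
  calc ∑ k ∈ Ico 1 n, (k : ℝ) ^ e ≤ ∑ k ∈ Ico 1 n, (k : ℝ) ^ (m - 1) :=
        sum_le_sum fun k hk => Real.rpow_le_rpow_of_exponent_le
          (Nat.one_le_cast.2 (mem_Ico.1 hk).1) (by linarith)
    _ ≤ ∑ k ∈ Icc 1 n, (k : ℝ) ^ (m - 1) :=
        sum_le_sum_of_subset_of_nonneg Ico_subset_Icc_self fun k _ _ => by positivity
    _ ≤ K * (n : ℝ) ^ m := by simpa using hsum n n.cast_nonneg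

/-- The order of magnitude `k^β n^{-α}` of the coefficient `a_{ni}`, where `k = n - i` and
`α = p + β`. -/
def arrayWeight (α β : ℝ) (n k : ℕ) : ℝ := (k : ℝ) ^ β * (n : ℝ) ^ (-α)

theorem arrayWeight_nonneg (α β : ℝ) (n k : ℕ) : 0 ≤ arrayWeight α β n k := by
  rw [arrayWeight]
  positivity

theorem arrayWeight_mul_threshold (α β δ : ℝ) {n k : ℕ} (hn : 0 < n) (hk : 0 < k) :
    arrayWeight α β n k * threshold α β δ (k, n) = δ := by
  rw [arrayWeight, threshold, Real.rpow_neg n.cast_nonneg, Real.rpow_neg k.cast_nonneg]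
  field_simp

theorem exists_sum_arrayWeight_rpow_le {p β s : ℝ} (hα : 0 < p + β) (hs : 0 < s)
    (hps : 1 < p * s) :
    ∃ K γ : ℝ, 0 < γ ∧ ∀ n : ℕ, 0 < n →
      ∑ k ∈ Ico 1 n, arrayWeight (p + β) β n k ^ s ≤ K * (n : ℝ) ^ (-γ) := by
  set m := max (β * s + 1) ((p + β) * s / 2)
  have hαs : 0 < (p + β) * s := mul_pos hα hs
  have hm : m < (p + β) * s := max_lt (by linarith) (half_lt_self hαs)
  obtain ⟨K, hsum⟩ := exists_sum_Ico_rpow_le (e := β * s)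
    ((half_pos hαs).trans_le (le_max_right _ _)) (le_max_left _ _)
  refine ⟨K, (p + β) * s - m, sub_pos.2 hm, fun n hn => ?_⟩
  have hn0 : (0 : ℝ) < n := Nat.cast_pos.2 hn
  calc ∑ k ∈ Ico 1 n, arrayWeight (p + β) β n k ^ s
      = (∑ k ∈ Ico 1 n, (k : ℝ) ^ (β * s)) * (n : ℝ) ^ (-(p + β) * s) := by
        rw [sum_mul]
        refine sum_congr rfl fun k _ => ?_
        rw [arrayWeight, Real.mul_rpow (by positivity) (by positivity),
          ← Real.rpow_mul k.cast_nonneg, ← Real.rpow_mul hn0.le]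
    _ ≤ K * (n : ℝ) ^ m * (n : ℝ) ^ (-(p + β) * s) := by gcongr; exact hsum n
    _ = K * (n : ℝ) ^ (-((p + β) * s - m)) := by
        rw [mul_assoc, ← Real.rpow_add hn0]
        ring_nf

/-- The function `h` for which the moment condition reads `C_V(h(|X|)) < ∞`. -/
def momentFun (r p β t : ℝ) : ℝ :=
  if β < -p / r then t ^ ((r - 1) / (p + β))
  else if β = -p / r then t ^ (r / p) * Real.log (1 + t)
  else t ^ (r / p)

section Moment

variable {r p β : ℝ}

theorem momentFun_of_lt (h : β < -p / r) (t : ℝ) :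
    momentFun r p β t = t ^ ((r - 1) / (p + β)) := if_pos h

theorem momentFun_of_eq (h : β = -p / r) (t : ℝ) :
    momentFun r p β t = t ^ (r / p) * Real.log (1 + t) := by
  rw [momentFun, if_neg h.not_lt, if_pos h]

theorem momentFun_of_gt (h : -p / r < β) (t : ℝ) : momentFun r p β t = t ^ (r / p) := by
  rw [momentFun, if_neg h.not_gt, if_neg h.ne']

theorem momentFun_nonneg {t : ℝ} (ht : 0 ≤ t) : 0 ≤ momentFun r p β t := by
  have hlog : 0 ≤ Real.log (1 + t) := Real.log_nonneg (by linarith)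
  unfold momentFun
  split_ifs <;> positivity

theorem momentFun_zero (hr : 1 < r) (hp : 0 < p) (hα : 0 < p + β) : momentFun r p β 0 = 0 := by
  have hτ : (r - 1) / (p + β) ≠ 0 := (div_pos (by linarith) hα).ne'
  have hq : r / p ≠ 0 := (div_pos (by linarith) hp).ne'
  unfold momentFun
  split_ifs <;> simp [hτ, hq]

theorem monotoneOn_momentFun (hr : 1 < r) (hp : 0 < p) (hα : 0 < p + β) :
    MonotoneOn (momentFun r p β) (Set.Ici 0) := by
  intro s (hs : 0 ≤ s) t (ht : 0 ≤ t) hst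
  have hlog : 0 ≤ Real.log (1 + s) := Real.log_nonneg (by linarith)
  unfold momentFun
  split_ifs <;> gcongr

theorem continuousOn_momentFun (hr : 1 < r) (hp : 0 < p) (hα : 0 < p + β) :
    ContinuousOn (momentFun r p β) (Set.Ici 0) := by
  have hτ : 0 ≤ (r - 1) / (p + β) := (div_pos (by linarith) hα).le
  have hq : 0 ≤ r / p := (div_pos (by linarith) hp).le
  unfold momentFun
  split_ifs
  · exact (Real.continuous_rpow_const hτ).continuousOn
  · refine (Real.continuous_rpow_const hq).continuousOn.mul (ContinuousOn.log (by fun_prop) ?_)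
    exact fun x (hx : 0 ≤ x) => by positivity
  · exact (Real.continuous_rpow_const hq).continuousOn

theorem tendsto_momentFun_atTop (hr : 1 < r) (hp : 0 < p) (hα : 0 < p + β) :
    Tendsto (momentFun r p β) atTop atTop := by
  have hτ : 0 < (r - 1) / (p + β) := div_pos (by linarith) hα
  have hq : 0 < r / p := div_pos (by linarith) hp
  unfold momentFun
  split_ifs
  · exact tendsto_rpow_atTop hτ
  · exact (tendsto_rpow_atTop hq).atTop_mul_atTop₀
      (Real.tendsto_log_atTop.comp (tendsto_atTop_add_const_left _ _ tendsto_id))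
  · exact tendsto_rpow_atTop hq

theorem div_le_div_of_lt_neg_div (hr : 0 < r) (hp : 0 < p) (hα : 0 < p + β) (h : β < -p / r) :
    r / p ≤ (r - 1) / (p + β) := by
  rw [lt_div_iff₀ hr] at h
  rw [div_le_div_iff₀ hp hα]
  linarith

theorem rpow_le_momentFun (hr : 0 < r) (hp : 0 < p) (hα : 0 < p + β) {s t : ℝ} (ht : 0 ≤ t)
    (hs : 0 ≤ s) (hsq : s ≤ r / p) : t ^ s ≤ 2 * (1 + momentFun r p β t) := by
  have hq : 0 ≤ r / p := (div_pos hr hp).le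
  have hnonneg : 0 ≤ momentFun r p β t := momentFun_nonneg ht
  refine (rpow_le_one_add_rpow hs hsq ht).trans ?_
  rcases lt_trichotomy β (-p / r) with h | h | h
  · rw [momentFun_of_lt h] at hnonneg ⊢
    linarith [rpow_le_one_add_rpow hq (div_le_div_of_lt_neg_div hr hp hα h) ht]
  · rw [momentFun_of_eq h]
    linarith [rpow_le_one_add_mul_log hq ht]
  · rw [momentFun_of_gt h] at hnonneg ⊢
    linarith

theorem exists_momentFun_div_le (hr : 0 < r) (hp : 0 < p) {δ : ℝ} (hδ : 0 < δ) :
    ∃ C C' : ℝ, 0 ≤ C ∧ 0 ≤ C' ∧ ∀ t : ℝ, 0 ≤ t →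
      momentFun r p β (t / δ) ≤ C * momentFun r p β t + C' := by
  rcases lt_trichotomy β (-p / r) with h | h | h
  · refine ⟨(δ ^ ((r - 1) / (p + β)))⁻¹, 0, by positivity, le_rfl, fun t ht => ?_⟩
    rw [momentFun_of_lt h, momentFun_of_lt h, Real.div_rpow ht hδ.le, add_zero, inv_mul_eq_div]
  · set L := Real.log (1 + 1 / δ)
    have hL : 0 ≤ L := Real.log_nonneg (le_add_of_nonneg_right (by positivity))
    refine ⟨(δ ^ (r / p))⁻¹ * (1 + 2 * L), (δ ^ (r / p))⁻¹ * L, by positivity, by positivity,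
      fun t ht => ?_⟩
    rw [momentFun_of_eq h, momentFun_of_eq h]
    have hlog : Real.log (1 + t / δ) ≤ Real.log (1 + t) + L := by
      rw [← Real.log_mul (by positivity) (by positivity)]
      refine Real.log_le_log (by positivity) ?_
      have : 0 ≤ t + 1 / δ := by positivity
      linarith [show (1 + t) * (1 + 1 / δ) = 1 + t / δ + (t + 1 / δ) by ring]
    calc (t / δ) ^ (r / p) * Real.log (1 + t / δ)
        ≤ (t / δ) ^ (r / p) * (Real.log (1 + t) + L) := by gcongr
      _ = (δ ^ (r / p))⁻¹ * (t ^ (r / p) * Real.log (1 + t) + t ^ (r / p) * L) := by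
          rw [Real.div_rpow ht hδ.le]
          ring
      _ ≤ (δ ^ (r / p))⁻¹ * (t ^ (r / p) * Real.log (1 + t) +
            (1 + 2 * (t ^ (r / p) * Real.log (1 + t))) * L) := by
          gcongr
          exact rpow_le_one_add_mul_log (div_pos hr hp).le ht
      _ = _ := by ring
  · refine ⟨(δ ^ (r / p))⁻¹, 0, by positivity, le_rfl, fun t ht => ?_⟩
    rw [momentFun_of_gt h, momentFun_of_gt h, Real.div_rpow ht hδ.le, add_zero, inv_mul_eq_div]

end Moment

section CountBound

variable {r p β : ℝ}

theorem countBound_exponent_identity (hp : 0 < p) (hα : 0 < p + β) :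
    (r - 1) / (p + β) + p⁻¹ * (β * ((r - 1) / (p + β)) + 1) = r / p := by
  field_simp
  ring

theorem countBound_exponent_lt_neg_one (hr : 0 < r) (hα : 0 < p + β) (h : β < -p / r) :
    β * ((r - 1) / (p + β)) < -1 := by
  rw [lt_div_iff₀ hr] at h
  rw [← mul_div_assoc, div_lt_iff₀ hα]
  linarith

theorem countBound_exponent_eq_neg_one (hr : 0 < r) (hα : 0 < p + β) (h : β = -p / r) :
    β * ((r - 1) / (p + β)) = -1 := by
  rw [eq_div_iff hr.ne'] at h
  rw [← mul_div_assoc, div_eq_iff hα.ne']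
  linarith

theorem neg_one_lt_countBound_exponent (hr : 0 < r) (hα : 0 < p + β) (h : -p / r < β) :
    -1 < β * ((r - 1) / (p + β)) := by
  rw [div_lt_iff₀ hr] at h
  rw [← mul_div_assoc, lt_div_iff₀ hα]
  linarith

theorem countBound_nonneg {U : ℝ} (hU : 0 ≤ U) (R : ℝ) : 0 ≤ countBound r p β U R := by
  rw [countBound]
  positivity

theorem countBound_of_eq (hr : 0 < r) (hp : 0 < p) (hα : 0 < p + β) (h : β = -p / r)
    (U R : ℝ) : countBound r p β U R = U ^ (r / p) * (harmonic ⌊R⌋₊ : ℚ) := by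
  have hexp := countBound_exponent_eq_neg_one hr hα h
  have hτ : (r - 1) / (p + β) = r / p := by
    have := countBound_exponent_identity (r := r) hp hα
    rwa [hexp, neg_add_cancel, mul_zero, add_zero] at this
  rw [countBound, hexp, hτ, harmonic_eq_sum_Icc]
  push_cast
  simp_rw [Real.rpow_neg_one]

theorem exists_countBound_le_of_lt (hr : 0 < r) (hα : 0 < p + β) (h : β < -p / r) :
    ∃ C : ℝ, 0 ≤ C ∧ ∀ U R : ℝ, 0 ≤ U → countBound r p β U R ≤ C * momentFun r p β U := by
  have hsum := Real.summable_nat_rpow.2 (countBound_exponent_lt_neg_one hr hα h)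
  refine ⟨∑' k : ℕ, (k : ℝ) ^ (β * ((r - 1) / (p + β))), tsum_nonneg fun k => by positivity,
    fun U R hU => ?_⟩
  rw [momentFun_of_lt h, countBound, mul_comm]
  gcongr
  exact hsum.sum_le_tsum _ fun k _ => by positivity

theorem countBound_le_of_eq (hr : 0 < r) (hp : 0 < p) (hα : 0 < p + β) (h : β = -p / r) {U : ℝ}
    (hU : 0 ≤ U) : countBound r p β U (U ^ p⁻¹) ≤ (2 + p⁻¹) * momentFun r p β U + 1 := by
  have hfloor : Real.log ⌊U ^ p⁻¹⌋₊ ≤ p⁻¹ * Real.log (1 + U) := by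
    rcases Nat.eq_zero_or_pos ⌊U ^ p⁻¹⌋₊ with h0 | hpos
    · rw [h0, Nat.cast_zero, Real.log_zero]
      have : 0 ≤ Real.log (1 + U) := Real.log_nonneg (by linarith)
      positivity
    · rw [← Real.log_rpow (by positivity)]
      refine Real.log_le_log (Nat.cast_pos.2 hpos) ((Nat.floor_le (by positivity)).trans ?_)
      gcongr
      linarith
  rw [countBound_of_eq hr hp hα h, momentFun_of_eq h]
  calc U ^ (r / p) * (harmonic ⌊U ^ p⁻¹⌋₊ : ℚ)
      ≤ U ^ (r / p) * (1 + p⁻¹ * Real.log (1 + U)) := by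
        gcongr
        exact (harmonic_le_one_add_log _).trans (by gcongr)
    _ = U ^ (r / p) + p⁻¹ * (U ^ (r / p) * Real.log (1 + U)) := by ring
    _ ≤ 1 + 2 * (U ^ (r / p) * Real.log (1 + U)) +
          p⁻¹ * (U ^ (r / p) * Real.log (1 + U)) := by
        gcongr
        exact rpow_le_one_add_mul_log (div_pos hr hp).le hU
    _ = _ := by ring

theorem exists_countBound_le_of_gt (hr : 1 < r) (hp : 0 < p) (hα : 0 < p + β) (h : -p / r < β) :
    ∃ C : ℝ, 0 ≤ C ∧ ∀ U : ℝ, 0 ≤ U →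
      countBound r p β U (U ^ p⁻¹) ≤ C * momentFun r p β U := by
  have hexp := neg_one_lt_countBound_exponent (zero_lt_one.trans hr) hα h
  obtain ⟨C, hC, hsum⟩ := exists_sum_rpow_sub_one_le
    (γ := β * ((r - 1) / (p + β)) + 1) (by linarith)
  refine ⟨C, hC.le, fun U hU => ?_⟩
  have hτ : 0 < (r - 1) / (p + β) := div_pos (by linarith) hα
  rw [momentFun_of_gt h, countBound]
  calc _ ≤ U ^ ((r - 1) / (p + β)) * (C * (U ^ p⁻¹) ^ (β * ((r - 1) / (p + β)) + 1)) := by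
        gcongr
        simpa only [add_sub_cancel_right] using hsum (U ^ p⁻¹) (by positivity)
    _ = C * U ^ (r / p) := by
        rw [← Real.rpow_mul hU, mul_left_comm,
          ← Real.rpow_add_of_nonneg hU hτ.le (mul_nonneg (by positivity) (by linarith)),
          countBound_exponent_identity hp hα]

theorem exists_countBound_le_momentFun (hr : 1 < r) (hp : 0 < p) (hα : 0 < p + β) :
    ∃ C C' : ℝ, 0 ≤ C ∧ 0 ≤ C' ∧ ∀ U : ℝ, 0 ≤ U →
      countBound r p β U (U ^ p⁻¹) ≤ C * momentFun r p β U + C' := by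
  have hr0 : 0 < r := zero_lt_one.trans hr
  rcases lt_trichotomy β (-p / r) with h | h | h
  · obtain ⟨C, hC, hle⟩ := exists_countBound_le_of_lt hr0 hα h
    exact ⟨C, 0, hC, le_rfl, fun U hU => (hle U _ hU).trans_eq (add_zero _).symm⟩
  · exact ⟨2 + p⁻¹, 1, by positivity, zero_le_one, fun U hU => countBound_le_of_eq hr0 hp hα h hU⟩
  · obtain ⟨C, hC, hle⟩ := exists_countBound_le_of_gt hr hp hα h
    exact ⟨C, 0, hC, le_rfl, fun U hU => (hle U hU).trans_eq (add_zero _).symm⟩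

theorem tendsto_rpow_div_atTop (hp : 0 < p) {L : ℝ} (hL : 0 < L) :
    Tendsto (fun U : ℝ => U ^ p⁻¹ / L) atTop atTop :=
  (tendsto_rpow_atTop (inv_pos.2 hp)).atTop_div_const hL

theorem eventually_momentFun_le_of_lt (hp : 0 < p) (h : β < -p / r) {L : ℝ} (hL : 0 < L) :
    ∀ᶠ U : ℝ in atTop, momentFun r p β U ≤ countBound r p β U (U ^ p⁻¹ / L) := by
  filter_upwards [(tendsto_rpow_div_atTop hp hL).eventually_ge_atTop 1, eventually_ge_atTop 0]
    with U hR hU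
  rw [momentFun_of_lt h, countBound]
  refine le_mul_of_one_le_right (by positivity) ?_
  have hmem : 1 ∈ Icc 1 ⌊U ^ p⁻¹ / L⌋₊ := mem_Icc.2 ⟨le_rfl, Nat.le_floor (by simpa using hR)⟩
  simpa using single_le_sum (f := fun k : ℕ => (k : ℝ) ^ (β * ((r - 1) / (p + β))))
    (fun k _ => by positivity) hmem

/-- Since `1 + U ≤ (U^{1/p} / L)^{2p}` for large `U`, the harmonic sum up to `U^{1/p} / L` controls
`log (1 + U)`. -/
theorem eventually_momentFun_le_of_eq (hr : 0 < r) (hp : 0 < p) (hα : 0 < p + β) (h : β = -p / r)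
    {L : ℝ} (hL : 0 < L) :
    ∀ᶠ U : ℝ in atTop, momentFun r p β U ≤ 2 * p * countBound r p β U (U ^ p⁻¹ / L) := by
  filter_upwards [eventually_ge_atTop (max 1 (2 * L ^ (2 * p)))] with U hU
  have hU1 : 1 ≤ U := (le_max_left _ _).trans hU
  have hU0 : 0 < U := zero_lt_one.trans_le hU1
  have hUL : 2 * L ^ (2 * p) ≤ U := (le_max_right _ _).trans hU
  have hpow : 1 + U ≤ (U ^ p⁻¹ / L) ^ (2 * p) := by
    rw [Real.div_rpow (by positivity) hL.le, le_div_iff₀ (by positivity), ← Real.rpow_mul hU0.le,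
      mul_comm 2 p, inv_mul_cancel_left₀ hp.ne', Real.rpow_two, mul_comm p 2]
    nlinarith
  have hlog : Real.log (1 + U) ≤ 2 * p * (harmonic ⌊U ^ p⁻¹ / L⌋₊ : ℚ) := calc
    Real.log (1 + U) ≤ Real.log ((U ^ p⁻¹ / L) ^ (2 * p)) := Real.log_le_log (by positivity) hpow
    _ = 2 * p * Real.log (U ^ p⁻¹ / L) := Real.log_rpow (by positivity) _
    _ ≤ 2 * p * Real.log ↑(⌊U ^ p⁻¹ / L⌋₊ + 1) := by
        gcongr
        push_cast
        exact (Nat.lt_floor_add_one _).le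
    _ ≤ 2 * p * (harmonic ⌊U ^ p⁻¹ / L⌋₊ : ℚ) := by
        gcongr
        exact log_add_one_le_harmonic _
  rw [momentFun_of_eq h, countBound_of_eq hr hp hα h, mul_left_comm]
  gcongr

theorem exists_eventually_momentFun_le_of_gt (hp : 0 < p) (hα : 0 < p + β) (h : -p / r < β)
    {L : ℝ} (hL : 0 < L) :
    ∃ C : ℝ, 0 ≤ C ∧ ∀ᶠ U : ℝ in atTop,
      momentFun r p β U ≤ C * countBound r p β U (U ^ p⁻¹ / L) := by
  set e := β * ((r - 1) / (p + β)) with he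
  obtain ⟨c, hc, hsum⟩ := exists_le_sum_Ioc_rpow e
  refine ⟨L ^ (e + 1) / c, by positivity, ?_⟩
  filter_upwards [(tendsto_rpow_div_atTop hp hL).eventually_ge_atTop 4, eventually_gt_atTop 0]
    with U hR hU
  set R := U ^ p⁻¹ / L with hR_def
  have hsub : ∑ n ∈ Ioc ⌊R / 2⌋₊ ⌊R⌋₊, (n : ℝ) ^ e ≤ ∑ n ∈ Icc 1 ⌊R⌋₊, (n : ℝ) ^ e :=
    sum_le_sum_of_subset_of_nonneg
      (fun n hn => by rw [mem_Ioc] at hn; exact mem_Icc.2 ⟨by lia, hn.2⟩)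
      fun n _ _ => by positivity
  rw [momentFun_of_gt h, countBound, ← he]
  calc U ^ (r / p) = U ^ ((r - 1) / (p + β)) * (L * R) ^ (e + 1) := by
        rw [hR_def, mul_div_cancel₀ _ hL.ne', ← Real.rpow_mul hU.le, ← Real.rpow_add hU,
          countBound_exponent_identity hp hα]
    _ = L ^ (e + 1) / c * (U ^ ((r - 1) / (p + β)) * (c * R ^ (e + 1))) := by
        rw [Real.mul_rpow hL.le (by positivity)]
        field_simp
    _ ≤ L ^ (e + 1) / c * (U ^ ((r - 1) / (p + β)) * ∑ n ∈ Icc 1 ⌊R⌋₊, (n : ℝ) ^ e) := by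
        gcongr
        exact (hsum R hR).trans hsub

theorem exists_momentFun_le_countBound (hr : 1 < r) (hp : 0 < p) (hα : 0 < p + β) {L : ℝ}
    (hL : 0 < L) :
    ∃ C C' : ℝ, 0 ≤ C ∧ 0 ≤ C' ∧ ∀ U : ℝ, 0 ≤ U →
      momentFun r p β U ≤ C * countBound r p β U (U ^ p⁻¹ / L) + C' := by
  have hr0 : 0 < r := zero_lt_one.trans hr
  suffices hlarge : ∃ C : ℝ, 0 ≤ C ∧ ∀ᶠ U : ℝ in atTop,
      momentFun r p β U ≤ C * countBound r p β U (U ^ p⁻¹ / L) by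
    obtain ⟨C, hC, hlarge⟩ := hlarge
    obtain ⟨U₀, hle, hU₀⟩ :=
      (eventually_forall_ge_atTop.2 hlarge |>.and (eventually_ge_atTop 0)).exists
    refine ⟨C, momentFun r p β U₀, hC, momentFun_nonneg hU₀, fun U hU => ?_⟩
    rcases le_total U₀ U with hcase | hcase
    · exact (hle U hcase).trans (le_add_of_nonneg_right (momentFun_nonneg hU₀))
    · exact (monotoneOn_momentFun hr hp hα hU hU₀ hcase).trans
        (le_add_of_nonneg_left (mul_nonneg hC (countBound_nonneg hU _)))
  rcases lt_trichotomy β (-p / r) with h | h | h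
  · refine ⟨1, zero_le_one, ?_⟩
    simpa only [one_mul] using eventually_momentFun_le_of_lt hp h hL
  · exact ⟨2 * p, by positivity, eventually_momentFun_le_of_eq hr0 hp hα h hL⟩
  · exact exists_eventually_momentFun_le_of_gt hp hα h hL

end CountBound

end

/-! ### Weighted sums and clipped variables -/

noncomputable section

open Finset

theorem tsum_pairWeight_mul (r : ℝ) (F : ℕ × ℕ → ℝ≥0∞) :
    ∑' z, pairWeight r z * F z =
      ∑' n : ℕ, ENNReal.ofReal ((n : ℝ) ^ (r - 2)) * ∑ k ∈ Ico 1 n, F (k, n) := by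
  rw [ENNReal.tsum_prod', ENNReal.tsum_comm]
  refine tsum_congr fun n => ?_
  rw [tsum_eq_sum (s := Ico 1 n), mul_sum]
  · exact sum_congr rfl fun k hk => by rw [pairWeight, if_pos (mem_Ico.1 hk)]
  · exact fun k hk => by rw [pairWeight, if_neg fun h => hk (mem_Ico.2 h), zero_mul]

theorem sum_Icc_comp_sub {M : Type*} [AddCommMonoid M] (n : ℕ) (f : ℕ → M) :
    ∑ i ∈ Icc 1 (n - 1), f (n - i) = ∑ k ∈ Ico 1 n, f k :=
  sum_nbij' (fun i => n - i) (fun k => n - k)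
    (fun i hi => by rw [mem_Icc] at hi; rw [mem_Ico]; lia)
    (fun k hk => by rw [mem_Ico] at hk; rw [mem_Icc]; lia)
    (fun i hi => by rw [mem_Icc] at hi; lia) (fun k hk => by rw [mem_Ico] at hk; lia)
    fun _ _ => rfl

theorem arrayApprox_iff_arrayWeight {a : ℕ → ℕ → ℝ} {p β : ℝ} :
    ArrayApprox a (fun n i => (((n : ℝ) - (i : ℝ)) / (n : ℝ)) ^ β * (1 / (n : ℝ)) ^ p) ↔
      ArrayApprox a (fun n i => arrayWeight (p + β) β n (n - i)) := by
  have hweight : ∀ n i : ℕ, i < n → (((n : ℝ) - (i : ℝ)) / (n : ℝ)) ^ β * (1 / (n : ℝ)) ^ p =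
      arrayWeight (p + β) β n (n - i) := fun n i hi => by
    have hn : (0 : ℝ) < n := Nat.cast_pos.2 (i.zero_le.trans_lt hi)
    rw [arrayWeight, ← Nat.cast_sub hi.le, Real.div_rpow (Nat.cast_nonneg _) hn.le, one_div,
      Real.inv_rpow hn.le, Real.rpow_neg hn.le, Real.rpow_add hn]
    field_simp
  unfold ArrayApprox
  refine exists₂_congr fun c C => and_congr_right' (and_congr_right' (exists_congr fun N => ?_))
  exact forall₂_congr fun n _ => forall₂_congr fun i hi => by
    simp only [hweight n i hi]

theorem sum_abs_rpow_le_sum_arrayWeight {α β C s : ℝ} (hC : 0 ≤ C) (hs : 0 ≤ s) {n : ℕ}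
    {A : ℕ → ℝ} (hA : ∀ i ∈ Icc 1 (n - 1), |A i| ≤ C * arrayWeight α β n (n - i)) :
    ∑ i ∈ Icc 1 (n - 1), |A i| ^ s ≤ C ^ s * ∑ k ∈ Ico 1 n, arrayWeight α β n k ^ s := by
  rw [← sum_Icc_comp_sub, mul_sum]
  refine sum_le_sum fun i hi => ?_
  rw [← Real.mul_rpow hC (arrayWeight_nonneg _ _ _ _)]
  exact Real.rpow_le_rpow (abs_nonneg _) (hA i hi) hs

/-- Truncation of `x` to `[-d, d]`. -/
def clip (d x : ℝ) : ℝ := max (-d) (min x d)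

theorem lipschitzWith_clip (d : ℝ) : LipschitzWith 1 (clip d) :=
  (LipschitzWith.id.min_const d).const_max (-d)

theorem measurable_clip (d : ℝ) : Measurable (clip d) :=
  (lipschitzWith_clip d).continuous.measurable

section Clip

variable {d s x : ℝ}

theorem clip_eq_self (h : |x| ≤ d) : clip d x = x := by
  obtain ⟨hge, hle⟩ := abs_le.1 h
  rw [clip, min_eq_left hle, max_eq_right hge]

theorem abs_clip (hd : 0 ≤ d) : |clip d x| = min |x| d := by
  rcases le_total |x| d with h | h
  · rw [clip_eq_self h, min_eq_left h]
  rw [min_eq_right h, clip]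
  rcases le_abs.1 h with hx | hx
  · rw [min_eq_right hx, max_eq_right (by linarith), abs_of_nonneg hd]
  · rw [min_eq_left (by linarith), max_eq_left (by linarith), abs_neg, abs_of_nonneg hd]

theorem abs_clip_le (hd : 0 ≤ d) : |clip d x| ≤ d := (abs_clip hd).trans_le (min_le_right _ _)

theorem clip_le_add_max : clip d x ≤ x + max (|x| - d) 0 := by
  refine max_le ?_ ((min_le_left _ _).trans (le_add_of_nonneg_right (le_max_right _ _)))
  linarith [neg_abs_le x, le_max_left (|x| - d) 0]

theorem abs_clip_rpow_le {u : ℝ} (hd : 0 < d) (hs : 0 < s) (hsu : s ≤ u) :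
    |clip d x| ^ u ≤ d ^ (u - s) * |x| ^ s := by
  rw [abs_clip hd.le]
  calc min |x| d ^ u = min |x| d ^ (u - s) * min |x| d ^ s := by
        rw [← Real.rpow_add_of_nonneg (by positivity) (sub_nonneg.2 hsu) hs.le, sub_add_cancel]
    _ ≤ d ^ (u - s) * |x| ^ s := by
        gcongr
        · exact min_le_right _ _
        · exact min_le_left _ _

theorem max_abs_sub_le (hd : 0 < d) (hs : 1 ≤ s) :
    max (|x| - d) 0 ≤ d ^ (1 - s) * |x| ^ s := by
  refine max_le ?_ (by positivity)
  rcases le_total |x| d with h | h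
  · exact (sub_nonpos.2 h).trans (by positivity)
  calc |x| - d ≤ |x| ^ (1 - s) * |x| ^ s := by
        rw [← Real.rpow_add (hd.trans_le h), sub_add_cancel, Real.rpow_one]
        linarith
    _ ≤ d ^ (1 - s) * |x| ^ s := by
        gcongr ?_ * _
        exact Real.rpow_le_rpow_of_nonpos hd h (sub_nonpos.2 hs)

end Clip

namespace SublinearExpectation

variable {Ω : Type*} [MeasurableSpace Ω] {S : SublinearExpectation Ω} {X : Ω → ℝ} {r p β d s : ℝ}

theorem isBdd_clip (hX : X ∈ S.H) (hd : 0 ≤ d) (A : ℝ) : S.IsBdd (fun ω => clip d (A * X ω)) :=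
  ⟨S.lipschitzWith_comp_mem (lipschitzWith_clip d) (S.const_mul_mem A hX), d,
    fun _ => abs_clip_le hd⟩

theorem isBdd_clip_sq (hX : X ∈ S.H) (hd : 0 ≤ d) (A : ℝ) :
    S.IsBdd (fun ω => clip d (A * X ω) ^ 2) := by
  simpa only [sq] using (isBdd_clip hX hd A).mul (isBdd_clip hX hd A)

theorem E_const_mul_eq_zero (hX : X ∈ S.H) (hEX : S.E X = 0) (hEX_neg : S.E (fun ω => -X ω) = 0)
    (A : ℝ) : S.E (fun ω => A * X ω) = 0 := by
  rcases le_total 0 A with hA | hA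
  · rw [S.pos_homog X hX A hA, hEX, mul_zero]
  · have hnegX : (fun ω => -X ω) ∈ S.H := by simpa using S.const_mul_mem (-1) hX
    simpa [hEX_neg] using S.pos_homog _ hnegX (-A) (neg_nonneg.2 hA)

theorem CountablySubadditive.exists_E_le_mul_abs_rpow (hS : S.CountablySubadditive) (hr : 0 < r)
    (hp : 0 < p) (hα : 0 < p + β)
    (hfin : ∫⁻ y in Set.Ioi (0 : ℝ), S.capacity {ω | y < momentFun r p β |X ω|} < ⊤)
    (hs : 0 < s) (hsq : s ≤ r / p) :
    ∃ M : ℝ, 0 ≤ M ∧ ∀ ξ ∈ S.H, (∀ ω, 0 ≤ ξ ω) → ∀ A c : ℝ, 0 < c →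
      (∀ ω, ξ ω ≤ c * |A * X ω| ^ s) → S.E ξ ≤ ((c * M * |A| ^ s : ℝ) : EReal) := by
  obtain ⟨D, hD, hE⟩ := hS.exists_E_le hfin
  refine ⟨2 * D, by positivity, fun ξ hξ hξ0 A c hc hle => ?_⟩
  rcases eq_or_ne A 0 with rfl | hA
  · have hξ_eq : ξ = fun _ => 0 := funext fun ω =>
      le_antisymm (by simpa [hs.ne'] using hle ω) (hξ0 ω)
    simp [hξ_eq, S.const, hs.ne']
  have hmoment : ∀ ω, ξ ω ≤ c * |A| ^ s * 2 * (1 + momentFun r p β |X ω|) := fun ω => calc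
    ξ ω ≤ c * (|A| ^ s * |X ω| ^ s) := by
      simpa only [abs_mul, Real.mul_rpow (abs_nonneg _) (abs_nonneg _)] using hle ω
    _ ≤ c * (|A| ^ s * (2 * (1 + momentFun r p β |X ω|))) := by
      gcongr
      exact rpow_le_momentFun hr hp hα (abs_nonneg _) hs.le hsq
    _ = _ := by ring
  convert hE ξ hξ hξ0 _ (by positivity) hmoment using 2
  ring

theorem CountablySubadditive.exists_ev_clip_sq_le (hS : S.CountablySubadditive) (hX : X ∈ S.H)
    (hr : 0 < r) (hp : 0 < p) (hα : 0 < p + β)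
    (hfin : ∫⁻ y in Set.Ioi (0 : ℝ), S.capacity {ω | y < momentFun r p β |X ω|} < ⊤)
    (hs : 0 < s) (hsq : s ≤ r / p) (hs2 : s ≤ 2) (hd : 0 < d) :
    ∃ M : ℝ, 0 ≤ M ∧ ∀ A : ℝ, S.ev (fun ω => clip d (A * X ω) ^ 2) ≤ M * |A| ^ s := by
  obtain ⟨M, hM, hE⟩ := hS.exists_E_le_mul_abs_rpow hr hp hα hfin hs hsq
  refine ⟨d ^ (2 - s) * M, by positivity, fun A => ?_⟩
  have hbdd := isBdd_clip_sq hX hd.le A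
  rw [← EReal.coe_le_coe_iff, hbdd.coe_ev]
  refine hE _ hbdd.1 (fun ω => sq_nonneg _) A _ (by positivity) fun ω => ?_
  rw [← sq_abs, ← Real.rpow_two]
  exact abs_clip_rpow_le hd hs hs2

theorem CountablySubadditive.exists_ev_clip_le_of_le_one (hS : S.CountablySubadditive)
    (hX : X ∈ S.H) (hr : 0 < r) (hp : 0 < p) (hα : 0 < p + β)
    (hfin : ∫⁻ y in Set.Ioi (0 : ℝ), S.capacity {ω | y < momentFun r p β |X ω|} < ⊤)
    (hs : 0 < s) (hsq : s ≤ r / p) (hs1 : s ≤ 1) (hd : 0 < d) :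
    ∃ M : ℝ, 0 ≤ M ∧ ∀ A : ℝ, S.ev (fun ω => clip d (A * X ω)) ≤ M * |A| ^ s := by
  obtain ⟨M, hM, hE⟩ := hS.exists_E_le_mul_abs_rpow hr hp hα hfin hs hsq
  refine ⟨d ^ (1 - s) * M, by positivity, fun A => ?_⟩
  have hbdd := isBdd_clip hX hd.le A
  have habs : S.IsBdd (fun ω => |clip d (A * X ω)|) :=
    ⟨S.abs_mem hbdd.1, d, fun ω => (abs_abs _).trans_le (abs_clip_le hd.le)⟩
  refine (ev_mono hbdd habs fun ω => le_abs_self _).trans ?_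
  rw [← EReal.coe_le_coe_iff, habs.coe_ev]
  refine hE _ habs.1 (fun ω => abs_nonneg _) A _ (by positivity) fun ω => ?_
  simpa only [Real.rpow_one] using abs_clip_rpow_le (x := A * X ω) hd hs hs1

theorem CountablySubadditive.exists_ev_clip_le_of_mean_zero (hS : S.CountablySubadditive)
    (hX : X ∈ S.H) (hr : 0 < r) (hp : 0 < p) (hα : 0 < p + β)
    (hfin : ∫⁻ y in Set.Ioi (0 : ℝ), S.capacity {ω | y < momentFun r p β |X ω|} < ⊤)
    (hEX : S.E X = 0) (hEX_neg : S.E (fun ω => -X ω) = 0)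
    (hs : 1 ≤ s) (hsq : s ≤ r / p) (hd : 0 < d) :
    ∃ M : ℝ, 0 ≤ M ∧ ∀ A : ℝ, S.ev (fun ω => clip d (A * X ω)) ≤ M * |A| ^ s := by
  obtain ⟨M, hM, hE⟩ := hS.exists_E_le_mul_abs_rpow hr hp hα hfin (zero_lt_one.trans_le hs) hsq
  refine ⟨d ^ (1 - s) * M, by positivity, fun A => ?_⟩
  have hbdd := isBdd_clip hX hd.le A
  have hAX := S.const_mul_mem A hX
  have hmean : S.E (fun ω => A * X ω) = 0 := E_const_mul_eq_zero hX hEX hEX_neg A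
  have hexcess : (fun ω => max (|A * X ω| - d) 0) ∈ S.H :=
    S.lipschitzWith_comp_mem (LipschitzWith.id.max_const 0)
      (S.add_mem (S.abs_mem hAX) (S.const_mem (-d)))
  rw [← EReal.coe_le_coe_iff, hbdd.coe_ev]
  calc S.E (fun ω => clip d (A * X ω))
      ≤ S.E (fun ω => A * X ω + max (|A * X ω| - d) 0) :=
        S.mono _ (S.add_mem hAX hexcess) _ hbdd.1 fun ω => clip_le_add_max
    _ ≤ S.E (fun ω => A * X ω) + S.E (fun ω => max (|A * X ω| - d) 0) :=
        S.subadd _ hAX _ hexcess (by simp [hmean]) (by simp [hmean])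
    _ = S.E (fun ω => max (|A * X ω| - d) 0) := by rw [hmean, zero_add]
    _ ≤ _ := hE _ hexcess (fun ω => le_max_right _ _) A _ (by positivity)
        fun ω => max_abs_sub_le hd hs

/-- Mean zero allows an exponent above `1`, which is what `1 < p * s` demands when `p ≤ 1`. -/
theorem CountablySubadditive.exists_ev_clip_le (hS : S.CountablySubadditive) (hX : X ∈ S.H)
    (hr : 1 < r) (hp : 0 < p) (hα : 0 < p + β)
    (hfin : ∫⁻ y in Set.Ioi (0 : ℝ), S.capacity {ω | y < momentFun r p β |X ω|} < ⊤)
    (hmean : p ≤ 1 → S.E X = 0 ∧ S.E (fun ω => -X ω) = 0) (hd : 0 < d) :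
    ∃ s M : ℝ, 0 < s ∧ 1 < p * s ∧ 0 ≤ M ∧
      ∀ A : ℝ, S.ev (fun ω => clip d (A * X ω)) ≤ M * |A| ^ s := by
  have hr0 : 0 < r := zero_lt_one.trans hr
  have hpr : p * (r / p) = r := mul_div_cancel₀ r hp.ne'
  rcases le_or_gt p 1 with hp1 | hp1
  · obtain ⟨M, hM, hle⟩ := hS.exists_ev_clip_le_of_mean_zero hX hr0 hp hα hfin (hmean hp1).1
      (hmean hp1).2 ((one_le_div hp).2 (hp1.trans hr.le)) le_rfl hd
    exact ⟨r / p, M, by positivity, by rwa [hpr], hM, hle⟩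
  · obtain ⟨M, hM, hle⟩ := hS.exists_ev_clip_le_of_le_one hX hr0 hp hα hfin
      (lt_min one_pos (div_pos hr0 hp)) (min_le_right _ _) (min_le_left _ _) hd
    refine ⟨min 1 (r / p), M, by positivity, ?_, hM, hle⟩
    rw [mul_min_of_nonneg _ _ hp.le, mul_one, hpr]
    exact lt_min hp1 hr

end SublinearExpectation

end

/-! ### Convergence from moments -/

section

open Finset Filter

section ChernoffExponent

variable {r ε d γ l n : ℝ}

theorem sq_mul_exp_le_mul_rpow (hr : 0 < r) (hε : 0 < ε) (hγ : 0 < γ) (hd : 4 * r * d ≤ γ * ε)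
    (hn : 1 ≤ n) (hl : l * ε = 2 * r * Real.log n) :
    l ^ 2 * Real.exp (l * d) ≤ (8 * r / (γ * ε)) ^ 2 * n ^ γ := by
  have hn0 : 0 < n := zero_lt_one.trans_le hn
  have hlog : 0 ≤ Real.log n := Real.log_nonneg hn
  obtain rfl : l = 2 * r * Real.log n / ε := eq_div_of_mul_eq hε.ne' hl
  have hlinear : 2 * r * Real.log n / ε ≤ 8 * r / (γ * ε) * n ^ (γ / 4) := calc
    2 * r * Real.log n / ε ≤ 2 * r * (n ^ (γ / 4) / (γ / 4)) / ε := by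
      gcongr
      exact Real.log_le_rpow_div hn0.le (by positivity)
    _ = _ := by field_simp; norm_num
  have hexp : Real.exp (2 * r * Real.log n / ε * d) ≤ n ^ (γ / 2) := by
    rw [Real.rpow_def_of_pos hn0, Real.exp_le_exp, div_mul_eq_mul_div, div_le_iff₀ hε]
    nlinarith
  calc (2 * r * Real.log n / ε) ^ 2 * Real.exp (2 * r * Real.log n / ε * d)
      ≤ (8 * r / (γ * ε) * n ^ (γ / 4)) ^ 2 * n ^ (γ / 2) := by gcongr
    _ = (8 * r / (γ * ε)) ^ 2 * (n ^ (γ / 4 * 2) * n ^ (γ / 2)) := by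
        rw [Real.rpow_mul hn0.le, Real.rpow_two]
        ring
    _ = (8 * r / (γ * ε)) ^ 2 * n ^ γ := by
        rw [← Real.rpow_add hn0]
        ring_nf

theorem exp_chernoff_le_mul_rpow {m b K : ℝ} (hr : 0 < r) (hε : 0 < ε) (hγ : 0 < γ)
    (hd : 4 * r * d ≤ γ * ε) (hn : 1 ≤ n) (hl : l * ε = 2 * r * Real.log n) (hm : m ≤ ε / 2)
    (hb0 : 0 ≤ b) (hb : b ≤ K * n ^ (-γ)) :
    Real.exp (-l * ε + (l * m + l ^ 2 * Real.exp (l * d) * b)) ≤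
      Real.exp ((8 * r / (γ * ε)) ^ 2 * K) * n ^ (-r) := by
  have hn0 : 0 < n := zero_lt_one.trans_le hn
  have hl0 : 0 ≤ l := nonneg_of_mul_nonneg_left
    (hl.ge.trans' (mul_nonneg (by positivity) (Real.log_nonneg hn))) hε
  have hmean : l * m ≤ l * (ε / 2) := mul_le_mul_of_nonneg_left hm hl0
  have hvariance : l ^ 2 * Real.exp (l * d) * b ≤ (8 * r / (γ * ε)) ^ 2 * K := calc
    l ^ 2 * Real.exp (l * d) * b ≤ (8 * r / (γ * ε)) ^ 2 * n ^ γ * (K * n ^ (-γ)) :=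
      mul_le_mul (sq_mul_exp_le_mul_rpow hr hε hγ hd hn hl) hb hb0 (by positivity)
    _ = (8 * r / (γ * ε)) ^ 2 * K * (n ^ γ * n ^ (-γ)) := by ring
    _ = (8 * r / (γ * ε)) ^ 2 * K := by rw [← Real.rpow_add hn0]; simp
  rw [Real.rpow_def_of_pos hn0, ← Real.exp_add, Real.exp_le_exp]
  linarith

end ChernoffExponent

theorem tsum_lt_top_of_eventually_le {ι : Type*} {f g : ι → ℝ≥0∞} (hf : ∀ i, f i ≠ ⊤)
    (hfg : ∀ᶠ i in cofinite, f i ≤ g i) (hg : ∑' i, g i < ⊤) : ∑' i, f i < ⊤ := by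
  classical
  set s := (eventually_cofinite.1 hfg).toFinset
  have hle : ∀ i, f i ≤ (if i ∈ s then f i else 0) + g i := fun i => by
    by_cases h : f i ≤ g i
    · exact h.trans le_add_self
    · rw [if_pos (by simpa [s] using h)]
      exact le_self_add
  refine (ENNReal.tsum_le_tsum hle).trans_lt ?_
  rw [ENNReal.tsum_add, tsum_eq_sum (s := s) fun i hi => if_neg hi]
  refine ENNReal.add_lt_top.2 ⟨ENNReal.sum_lt_top.2 fun i hi => ?_, hg⟩
  rw [if_pos hi]
  exact (hf i).lt_top

theorem lt_maxAbsWeightedSum_iff {Ω : Type*} {a : ℕ → ℕ → ℝ} {X : ℕ → Ω → ℝ} {n : ℕ+} {ω : Ω}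
    {ε : ℝ} :
    ε < maxAbsWeightedSum a X n ω ↔ ∃ j < (n : ℕ), ε < |∑ i ∈ Icc 1 j, a n i * X i ω| := by
  simp [maxAbsWeightedSum, Finset.lt_sup'_iff]

theorem abs_mul_le_of_le_threshold {α β C δ A x : ℝ} {n k : ℕ} (hk : 0 < k) (hkn : k < n)
    (hA : |A| ≤ C * arrayWeight α β n k) (hx : |x| ≤ threshold α β δ (k, n)) :
    |A * x| ≤ C * δ := by
  rw [abs_mul, ← arrayWeight_mul_threshold α β δ (hk.trans hkn) hk, ← mul_assoc]
  exact mul_le_mul hA hx (abs_nonneg _) ((abs_nonneg _).trans hA)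

/-- Off the event that some summand exceeds `C * δ`, clipping at that level changes nothing. -/
theorem setOf_lt_maxAbsWeightedSum_subset {Ω : Type*} {Xs : ℕ → Ω → ℝ}
    {a : ℕ → ℕ → ℝ} {n : ℕ+} {α β C δ : ℝ}
    (ha : ∀ i ∈ Icc 1 ((n : ℕ) - 1), |a n i| ≤ C * arrayWeight α β n (n - i)) (ε : ℝ) :
    {ω | ε < maxAbsWeightedSum a Xs n ω} ⊆
      (⋃ i ∈ Icc 1 ((n : ℕ) - 1), {ω | threshold α β δ (n - i, n) < |Xs i ω|}) ∪
        ({ω | ∃ j ≤ (n : ℕ) - 1, ε < ∑ i ∈ Icc 1 j, clip (C * δ) (a n i * Xs i ω)} ∪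
          {ω | ∃ j ≤ (n : ℕ) - 1, ε < ∑ i ∈ Icc 1 j, clip (C * δ) (-a n i * Xs i ω)}) := by
  intro ω hω
  obtain ⟨j, hjn, hj⟩ := lt_maxAbsWeightedSum_iff.1 hω
  refine or_iff_not_imp_left.2 fun hsmall => ?_
  simp only [Set.mem_iUnion, Set.mem_ofPred_eq, not_exists, not_lt] at hsmall
  have hterm : ∀ i ∈ Icc 1 j, |a n i * Xs i ω| ≤ C * δ := fun i hi => by
    rw [mem_Icc] at hi
    have hi' : i ∈ Icc 1 ((n : ℕ) - 1) := mem_Icc.2 (by lia)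
    exact abs_mul_le_of_le_threshold (by lia) (by lia) (ha i hi') (hsmall i hi')
  refine (lt_abs.1 hj).imp (fun h => ⟨j, by lia, h.trans_eq ?_⟩) fun h => ⟨j, by lia, h.trans_eq ?_⟩
  · exact sum_congr rfl fun i hi => (clip_eq_self (hterm i hi)).symm
  · rw [← sum_neg_distrib]
    exact sum_congr rfl fun i hi => by
      rw [neg_mul, clip_eq_self ((abs_neg _).trans_le (hterm i hi))]

namespace SublinearExpectation

variable {Ω : Type*} [MeasurableSpace Ω] {S : SublinearExpectation Ω} {X : Ω → ℝ}
  {Xs : ℕ → Ω → ℝ} {r p β : ℝ}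

theorem tsum_pairWeight_mul_capacity_lt_top (hr : 1 < r) (hp : 0 < p) (hα : 0 < p + β)
    (hfin : ∫⁻ y in Set.Ioi (0 : ℝ), S.capacity {ω | y < momentFun r p β |X ω|} < ⊤)
    {δ : ℝ} (hδ : 0 < δ) :
    ∑' z, pairWeight r z * S.capacity {ω | threshold (p + β) β δ z < |X ω|} < ⊤ := by
  obtain ⟨C₁, hC₁, hcount⟩ := exists_thresholdCount_le hr hp hα
  obtain ⟨C₂, D₂, hC₂, hD₂, hbound⟩ := exists_countBound_le_momentFun hr hp hα
  obtain ⟨C₃, D₃, hC₃, hD₃, hscale⟩ :=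
    exists_momentFun_div_le (β := β) (zero_lt_one.trans hr) hp hδ
  have hw : ∀ T, 0 ≤ T → thresholdCount r (p + β) β δ T ≤
      ENNReal.ofReal (C₁ * C₂ * C₃) * ENNReal.ofReal (momentFun r p β T) +
        ENNReal.ofReal (C₁ * (C₂ * D₃ + D₂)) := fun T hT => by
    have hT0 : 0 ≤ momentFun r p β T := momentFun_nonneg hT
    rw [← ENNReal.ofReal_mul (by positivity), ← ENNReal.ofReal_add (by positivity) (by positivity)]
    refine (hcount δ T hδ hT).trans (ENNReal.ofReal_le_ofReal ?_)
    calc C₁ * countBound r p β (T / δ) ((T / δ) ^ p⁻¹)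
        ≤ C₁ * (C₂ * momentFun r p β (T / δ) + D₂) := by gcongr; exact hbound _ (by positivity)
      _ ≤ C₁ * (C₂ * (C₃ * momentFun r p β T + D₃) + D₂) := by gcongr; exact hscale T hT
      _ = _ := by ring
  exact (tsum_mul_capacity_le_lintegral (threshold_nonneg hδ.le)
    (monotoneOn_momentFun hr hp hα) ENNReal.ofReal_ne_top hw _).trans_lt
      (ENNReal.add_lt_top.2 ⟨ENNReal.mul_lt_top ENNReal.ofReal_lt_top hfin, ENNReal.ofReal_lt_top⟩)

theorem lintegral_momentFun_lt_top_of_tsum (hr : 1 < r) (hp : 0 < p) (hα : 0 < p + β)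
    (hfin : ∑' z, pairWeight r z * S.capacity {ω | threshold (p + β) β 1 z < |X ω|} < ⊤) :
    ∫⁻ y in Set.Ioi (0 : ℝ), S.capacity {ω | y < momentFun r p β |X ω|} < ⊤ := by
  obtain ⟨c, hc, hcount⟩ := exists_le_thresholdCount (r := r) hp hα
  obtain ⟨C, D, hC, hD, hbound⟩ :=
    exists_momentFun_le_countBound hr hp hα (L := 4 ^ ((p + β) / p)) (by positivity)
  have hw : ∀ T, 0 ≤ T → ENNReal.ofReal (momentFun r p β T) ≤
      ENNReal.ofReal (C / c) * thresholdCount r (p + β) β 1 T + ENNReal.ofReal D := fun T hT => by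
    have hle := hcount 1 T one_pos hT
    rw [div_one] at hle
    calc ENNReal.ofReal (momentFun r p β T)
        ≤ ENNReal.ofReal (C / c * (c * countBound r p β T (T ^ p⁻¹ / 4 ^ ((p + β) / p))) + D) := by
          refine ENNReal.ofReal_le_ofReal ((hbound T hT).trans_eq ?_)
          rw [← mul_assoc, div_mul_cancel₀ C hc.ne']
      _ = ENNReal.ofReal (C / c) *
            ENNReal.ofReal (c * countBound r p β T (T ^ p⁻¹ / 4 ^ ((p + β) / p))) +
              ENNReal.ofReal D := by
          rw [ENNReal.ofReal_add _ hD, ENNReal.ofReal_mul (by positivity)]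
          have := countBound_nonneg (r := r) (p := p) (β := β) hT (T ^ p⁻¹ / 4 ^ ((p + β) / p))
          positivity
      _ ≤ _ := by gcongr
  exact (lintegral_le_tsum_mul_capacity (monotoneOn_momentFun hr hp hα)
    (continuousOn_momentFun hr hp hα) (momentFun_zero hr hp hα) (tendsto_momentFun_atTop hr hp hα)
    ENNReal.ofReal_ne_top hw fun ω => abs_nonneg _).trans_lt
      (ENNReal.add_lt_top.2 ⟨ENNReal.mul_lt_top ENNReal.ofReal_lt_top hfin, ENNReal.ofReal_lt_top⟩)

theorem IdentDistrib.capacity_lt_abs_eq {Y : Ω → ℝ} (h : S.IdentDistrib X Y) (hX : X ∈ S.H)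
    (hY : Y ∈ S.H) (t : ℝ) : S.capacity {ω | t < |X ω|} = S.capacity {ω | t < |Y ω|} :=
  h.capacity_preimage_eq (S.measurable_of_mem _ hX) (S.measurable_of_mem _ hY)
    (measurableSet_lt measurable_const measurable_id.abs)

theorem IndepSeq.capacity_exists_lt_sum_clip_le (hindep : S.IndepSeq Xs) (hX : X ∈ S.H)
    (hXs : ∀ n, 1 ≤ n → Xs n ∈ S.H) (hident : ∀ n, 1 ≤ n → S.IdentDistrib (Xs n) X)
    {d : ℝ} (hd : 0 ≤ d) {s₁ s₂ M₁ M₂ : ℝ} (hM₁ : 0 ≤ M₁) (hM₂ : 0 ≤ M₂)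
    (hmean : ∀ A : ℝ, S.ev (fun ω => clip d (A * X ω)) ≤ M₁ * |A| ^ s₁)
    (hsq : ∀ A : ℝ, S.ev (fun ω => clip d (A * X ω) ^ 2) ≤ M₂ * |A| ^ s₂)
    {l : ℝ} (hl : 0 < l) (ε : ℝ) (A : ℕ → ℝ) (m : ℕ) :
    S.capacity {ω | ∃ j ≤ m, ε < ∑ i ∈ Icc 1 j, clip d (A i * Xs i ω)} ≤
      ENNReal.ofReal (Real.exp (-l * ε + (l * (M₁ * ∑ i ∈ Icc 1 m, |A i| ^ s₁) +
        l ^ 2 * Real.exp (l * d) * (M₂ * ∑ i ∈ Icc 1 m, |A i| ^ s₂)))) := by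
  have hclip (i) : Measurable fun y => clip d (A i * y) :=
    (measurable_clip d).comp (measurable_const_mul (A i))
  rw [mul_sum _ _ M₁, mul_sum _ _ M₂]
  exact hindep.capacity_exists_lt_sum_le hXs (Z := fun i y => clip d (A i * y)) hclip
    (fun _ _ => abs_clip_le hd) (fun i hi => (isBdd_clip (hXs i hi) hd (A i)).1)
    (fun i hi => ((hident i hi).ev_eq (hclip i) (isBdd_clip (hXs i hi) hd (A i))
      (isBdd_clip hX hd (A i))).trans_le (hmean (A i)))
    (fun i hi => ((hident i hi).ev_eq ((hclip i).pow_const 2) (isBdd_clip_sq (hXs i hi) hd (A i))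
      (isBdd_clip_sq hX hd (A i))).trans_le (hsq (A i)))
    (fun i => by positivity) (fun i => by positivity) hl ε m

/-- The level `d` is fixed before the exponent of the mean estimate is known, since it depends on
the decay rate `γ` of the variance sums alone. -/
theorem CountablySubadditive.exists_eventually_capacity_clip_le (hS : S.CountablySubadditive)
    (hX : X ∈ S.H) (hXs : ∀ n, 1 ≤ n → Xs n ∈ S.H) (hindep : S.IndepSeq Xs)
    (hident : ∀ n, 1 ≤ n → S.IdentDistrib (Xs n) X)
    (hr : 1 < r) (hp : 1 / 2 < p) (hα : 0 < p + β)
    (hfin : ∫⁻ y in Set.Ioi (0 : ℝ), S.capacity {ω | y < momentFun r p β |X ω|} < ⊤)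
    (hmean : p ≤ 1 → S.E X = 0 ∧ S.E (fun ω => -X ω) = 0) {C ε : ℝ} (hC : 0 ≤ C) (hε : 0 < ε) :
    ∃ d K : ℝ, 0 < d ∧ ∀ᶠ n : ℕ in atTop, ∀ A : ℕ → ℝ,
      (∀ i ∈ Icc 1 (n - 1), |A i| ≤ C * arrayWeight (p + β) β n (n - i)) →
        S.capacity {ω | ∃ j ≤ n - 1, ε < ∑ i ∈ Icc 1 j, clip d (A i * Xs i ω)} ≤
          ENNReal.ofReal (K * (n : ℝ) ^ (-r)) := by
  have hr0 : 0 < r := zero_lt_one.trans hr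
  have hp0 : 0 < p := by linarith
  set s₂ := min 2 (r / p)
  have hs₂ : 0 < s₂ := lt_min two_pos (div_pos hr0 hp0)
  have hps₂ : 1 < p * s₂ := by
    rw [mul_min_of_nonneg _ _ hp0.le, mul_div_cancel₀ _ hp0.ne']
    exact lt_min (by linarith) hr
  obtain ⟨K₂, γ, hγ, hsum₂⟩ := exists_sum_arrayWeight_rpow_le hα hs₂ hps₂
  set d := γ * ε / (4 * r)
  have hd : 0 < d := by positivity
  obtain ⟨M₂, hM₂, hev₂⟩ :=
    hS.exists_ev_clip_sq_le hX hr0 hp0 hα hfin hs₂ (min_le_right _ _) (min_le_left _ _) hd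
  obtain ⟨s₁, M₁, hs₁, hps₁, hM₁, hev₁⟩ := hS.exists_ev_clip_le hX hr hp0 hα hfin hmean hd
  obtain ⟨K₁, γ₁, hγ₁, hsum₁⟩ := exists_sum_arrayWeight_rpow_le hα hs₁ hps₁
  have hdrift : Tendsto (fun n : ℕ => M₁ * (C ^ s₁ * (K₁ * (n : ℝ) ^ (-γ₁)))) atTop (nhds 0) := by
    simpa using (((tendsto_rpow_neg_atTop hγ₁).comp tendsto_natCast_atTop_atTop).const_mul
      K₁ |>.const_mul (C ^ s₁)).const_mul M₁
  refine ⟨d, Real.exp ((8 * r / (γ * ε)) ^ 2 * (M₂ * (C ^ s₂ * K₂))), hd, ?_⟩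
  filter_upwards [hdrift.eventually_le_const (half_pos hε), eventually_ge_atTop 2]
    with n hn_drift hn2 A hA
  have hn : 0 < n := two_pos.trans_le hn2
  have hlog : 0 < Real.log n := Real.log_pos (Nat.one_lt_cast.2 hn2)
  refine (hindep.capacity_exists_lt_sum_clip_le hX hXs hident hd.le hM₁ hM₂ hev₁ hev₂
    (l := 2 * r * Real.log n / ε) (by positivity) ε A (n - 1)).trans (ENNReal.ofReal_le_ofReal
      (exp_chernoff_le_mul_rpow hr0 hε hγ (mul_div_cancel₀ _ (by positivity)).le
        (Nat.one_le_cast.2 hn) (div_mul_cancel₀ _ hε.ne') ?_ (by positivity) ?_))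
  · refine le_trans ?_ hn_drift
    gcongr
    exact (sum_abs_rpow_le_sum_arrayWeight hC hs₁.le hA).trans (by gcongr; exact hsum₁ n hn)
  · rw [mul_assoc, mul_assoc]
    gcongr
    exact (sum_abs_rpow_le_sum_arrayWeight hC hs₂.le hA).trans (by gcongr; exact hsum₂ n hn)

theorem capacity_lt_maxAbsWeightedSum_le (hX : X ∈ S.H) (hXs : ∀ n, 1 ≤ n → Xs n ∈ S.H)
    (hident : ∀ n, 1 ≤ n → S.IdentDistrib (Xs n) X) {a : ℕ → ℕ → ℝ} {n : ℕ+} {α C δ ε : ℝ}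
    {v : ℝ≥0∞} (ha : ∀ i ∈ Icc 1 ((n : ℕ) - 1), |a n i| ≤ C * arrayWeight α β n (n - i))
    (hv : ∀ A : ℕ → ℝ,
      (∀ i ∈ Icc 1 ((n : ℕ) - 1), |A i| ≤ C * arrayWeight α β n (n - i)) →
        S.capacity {ω | ∃ j ≤ (n : ℕ) - 1, ε < ∑ i ∈ Icc 1 j, clip (C * δ) (A i * Xs i ω)} ≤ v) :
    S.capacity {ω | ε < maxAbsWeightedSum a Xs n ω} ≤
      ∑ k ∈ Ico 1 (n : ℕ), S.capacity {ω | threshold α β δ (k, n) < |X ω|} + (v + v) := by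
  have hXm (i) (hi : 1 ≤ i) : Measurable (Xs i) := S.measurable_of_mem _ (hXs i hi)
  have hlarge : ∀ i ∈ Icc 1 ((n : ℕ) - 1),
      MeasurableSet {ω | threshold α β δ ((n : ℕ) - i, n) < |Xs i ω|} := fun i hi =>
    measurableSet_lt measurable_const (hXm i (mem_Icc.1 hi).1).abs
  have hclip (A : ℕ → ℝ) : MeasurableSet
      {ω | ∃ j ≤ (n : ℕ) - 1, ε < ∑ i ∈ Icc 1 j, clip (C * δ) (A i * Xs i ω)} :=
    measurableSet_exists_le_lt (fun j => Finset.measurable_fun_sum _ fun i hi =>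
      (measurable_clip _).comp ((hXm i (mem_Icc.1 hi).1).const_mul _)) _ _
  refine (capacity_mono (setOf_lt_maxAbsWeightedSum_subset (δ := δ) ha ε)).trans ?_
  refine (capacity_union_le (Finset.measurableSet_biUnion _ hlarge)
    ((hclip _).union (hclip _))).trans (add_le_add ?_ ?_)
  · refine (capacity_biUnion_le _ hlarge).trans_eq ?_
    rw [← sum_Icc_comp_sub]
    exact sum_congr rfl fun i hi =>
      (hident i (mem_Icc.1 hi).1).capacity_lt_abs_eq (hXs i (mem_Icc.1 hi).1) hX _
  · exact (capacity_union_le (hclip _) (hclip _)).trans (add_le_add (hv _ ha)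
      (hv _ fun i hi => (abs_neg _).trans_le (ha i hi)))

theorem CountablySubadditive.tsum_capacity_maxAbsWeightedSum_lt_top (hS : S.CountablySubadditive)
    (hX : X ∈ S.H) (hXs : ∀ n, 1 ≤ n → Xs n ∈ S.H) (hindep : S.IndepSeq Xs)
    (hident : ∀ n, 1 ≤ n → S.IdentDistrib (Xs n) X)
    (hr : 1 < r) (hp : 1 / 2 < p) (hα : 0 < p + β)
    (hfin : ∫⁻ y in Set.Ioi (0 : ℝ), S.capacity {ω | y < momentFun r p β |X ω|} < ⊤)
    (hmean : p ≤ 1 → S.E X = 0 ∧ S.E (fun ω => -X ω) = 0) {a : ℕ → ℕ → ℝ}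
    (ha : ArrayApprox a fun n i => arrayWeight (p + β) β n (n - i)) {ε : ℝ} (hε : 0 < ε) :
    ∑' n : ℕ+, ENNReal.ofReal (((n : ℕ) : ℝ) ^ (r - 2)) *
      S.capacity {ω | ε < maxAbsWeightedSum a Xs n ω} < ⊤ := by
  obtain ⟨c, C, hc, hC, N, ha⟩ := ha
  obtain ⟨d, K, hd, hclip⟩ := hS.exists_eventually_capacity_clip_le hX hXs hindep hident hr hp hα
    hfin hmean hC.le hε
  set g : ℕ → ℝ≥0∞ := fun n => ENNReal.ofReal ((n : ℝ) ^ (r - 2)) *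
      ∑ k ∈ Ico 1 n, S.capacity {ω | threshold (p + β) β (d / C) (k, n) < |X ω|} +
    (ENNReal.ofReal (K * (n : ℝ) ^ (-2 : ℝ)) + ENNReal.ofReal (K * (n : ℝ) ^ (-2 : ℝ))) with hg_def
  have hle : ∀ᶠ n : ℕ+ in cofinite, ENNReal.ofReal (((n : ℕ) : ℝ) ^ (r - 2)) *
      S.capacity {ω | ε < maxAbsWeightedSum a Xs n ω} ≤ g n := by
    rw [← Nat.cofinite_eq_atTop] at hclip
    have hN : ∀ᶠ n : ℕ in cofinite, N ≤ n := by
      rw [Nat.cofinite_eq_atTop]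
      exact eventually_ge_atTop N
    filter_upwards [PNat.coe_injective.tendsto_cofinite.eventually (hclip.and hN)] with n hn
    obtain ⟨hclip, hnN⟩ := hn
    have ha_le : ∀ i ∈ Icc 1 ((n : ℕ) - 1), |a n i| ≤ C * arrayWeight (p + β) β n (n - i) :=
      fun i hi => by
        obtain ⟨hge, hle⟩ := ha n hnN i (by rw [mem_Icc] at hi; lia)
        rwa [abs_of_nonneg ((mul_nonneg hc.le (arrayWeight_nonneg _ _ _ _)).trans hge)]
    rw [← mul_div_cancel₀ d hC.ne'] at hclip
    have hpow : (n : ℝ) ^ (r - 2) * (K * (n : ℝ) ^ (-r)) = K * (n : ℝ) ^ (-2 : ℝ) := by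
      rw [mul_left_comm, ← Real.rpow_add (Nat.cast_pos.2 n.pos)]
      ring_nf
    refine (mul_le_mul_right (capacity_lt_maxAbsWeightedSum_le hX hXs hident ha_le hclip)
      _).trans_eq ?_
    rw [mul_add, mul_add, ← ENNReal.ofReal_mul (by positivity), hpow]
  refine tsum_lt_top_of_eventually_le (fun n => ENNReal.mul_ne_top ENNReal.ofReal_ne_top
    (capacity_ne_top _)) hle ((ENNReal.tsum_comp_le_tsum_of_injective PNat.coe_injective g).trans_lt
      ?_)
  have hsummable : ∑' n : ℕ, ENNReal.ofReal (K * (n : ℝ) ^ (-2 : ℝ)) < ⊤ :=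
    ((Real.summable_nat_rpow.2 (by norm_num)).mul_left K).tsum_ofReal_lt_top
  have hthreshold := tsum_pairWeight_mul_capacity_lt_top hr (by linarith) hα hfin (div_pos hd hC)
  rw [tsum_pairWeight_mul] at hthreshold
  rw [hg_def, ENNReal.tsum_add, ENNReal.tsum_add]
  exact ENNReal.add_lt_top.2 ⟨hthreshold, ENNReal.add_lt_top.2 ⟨hsummable, hsummable⟩⟩

end SublinearExpectation

end

/-! ### Moments from convergence -/

noncomputable section

open Finset Filter

theorem exists_le_sum_Ioc_two_mul_rpow (e : ℝ) :
    ∃ c : ℝ, 0 < c ∧ ∀ n : ℕ, 2 ≤ n →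
      c * (2 * (n : ℝ)) ^ (e + 1) ≤ ∑ m ∈ Ioc n (2 * n), (m : ℝ) ^ e := by
  obtain ⟨c, hc, hsum⟩ := exists_le_sum_Ioc_rpow e
  refine ⟨c, hc, fun n hn => ?_⟩
  have hn' : (2 : ℝ) ≤ n := Nat.ofNat_le_cast.2 hn
  have hfloor : ⌊2 * (n : ℝ)⌋₊ = 2 * n := by exact_mod_cast Nat.floor_natCast (R := ℝ) (2 * n)
  have h := hsum (2 * n) (by linarith)
  rwa [mul_div_cancel_left₀ _ two_ne_zero, Nat.floor_natCast, hfloor] at h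

theorem le_half_of_one_sub_exp_neg_le {u : ℝ} (h : 1 - Real.exp (-u) ≤ 1 / 3) : u ≤ 1 / 2 := by
  have hle : Real.exp (-u) * (u + 1) ≤ 1 := calc
    Real.exp (-u) * (u + 1) ≤ Real.exp (-u) * Real.exp u := by gcongr; exact Real.add_one_le_exp u
    _ = 1 := by rw [← Real.exp_add, neg_add_cancel, Real.exp_zero]
  nlinarith

theorem le_two_mul_one_sub_exp_neg {u : ℝ} (hu0 : 0 ≤ u) (hu : u ≤ 1 / 2) :
    u ≤ 2 * (1 - Real.exp (-u)) := by
  have h := (abs_le.1 (Real.abs_exp_sub_one_sub_id_le (x := -u)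
    (by rw [abs_neg, abs_of_nonneg hu0]; linarith))).2
  nlinarith

theorem mul_lt_abs_mul_of_threshold_lt {α β c δ A x : ℝ} {n k : ℕ} (hk : 0 < k) (hkn : k < n)
    (hc : 0 < c) (hA : c * arrayWeight α β n k ≤ A) (hx : threshold α β δ (k, n) < |x|) :
    c * δ < |A * x| := by
  have hn : 0 < n := hk.trans hkn
  have hweight : 0 < c * arrayWeight α β n k := by
    rw [arrayWeight]
    positivity
  rw [abs_mul, ← arrayWeight_mul_threshold α β δ hn hk, ← mul_assoc]
  calc c * arrayWeight α β n k * threshold α β δ (k, n)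
      < c * arrayWeight α β n k * |x| := mul_lt_mul_of_pos_left hx hweight
    _ ≤ |A| * |x| := by gcongr; exact hA.trans (le_abs_self A)

theorem half_lt_maxAbsWeightedSum {Ω : Type*} {a : ℕ → ℕ → ℝ} {X : ℕ → Ω → ℝ} {n : ℕ+} {ω : Ω}
    {i : ℕ} {t : ℝ} (hi : i ∈ Icc 1 ((n : ℕ) - 1)) (ht : t < |a n i * X i ω|) :
    t / 2 < maxAbsWeightedSum a X n ω := by
  obtain ⟨j, rfl⟩ : ∃ j, i = j + 1 := Nat.exists_eq_add_one.2 (mem_Icc.1 hi).1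
  rw [mem_Icc] at hi
  by_contra! hle
  have hpartial : ∀ k < (n : ℕ), |∑ i ∈ Icc 1 k, a n i * X i ω| ≤ t / 2 := fun k hk =>
    not_lt.1 fun h => hle.not_gt (lt_maxAbsWeightedSum_iff.2 ⟨k, hk, h⟩)
  refine ht.not_ge ?_
  calc |a n (j + 1) * X (j + 1) ω|
      = |∑ i ∈ Icc 1 (j + 1), a n i * X i ω - ∑ i ∈ Icc 1 j, a n i * X i ω| := by
        rw [sum_Icc_succ_top (by lia), add_sub_cancel_left]
    _ ≤ |∑ i ∈ Icc 1 (j + 1), a n i * X i ω| + |∑ i ∈ Icc 1 j, a n i * X i ω| := abs_sub _ _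
    _ ≤ t / 2 + t / 2 := add_le_add (hpartial _ (by lia)) (hpartial _ (by lia))
    _ = t := add_halves t

namespace SublinearExpectation

variable {Ω : Type*} [MeasurableSpace Ω] {S : SublinearExpectation Ω} {X : Ω → ℝ}
  {Xs : ℕ → Ω → ℝ} {r p β : ℝ}

/-- The expected number, in terms of the capacity, of weighted summands of the `n`-th row that
exceed `δ`: the sum over `1 ≤ k < n` of the capacities of `{|X| > δ n^α k^{-β}}`. -/
def tailSum (S : SublinearExpectation Ω) (X : Ω → ℝ) (α β δ : ℝ) (n : ℕ) : ℝ :=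
  ∑ k ∈ Ico 1 n, (S.capacity {ω | threshold α β δ (k, n) < |X ω|}).toReal

theorem tailSum_nonneg (α β δ : ℝ) (n : ℕ) : 0 ≤ S.tailSum X α β δ n :=
  sum_nonneg fun _ _ => ENNReal.toReal_nonneg

theorem ofReal_tailSum (α β δ : ℝ) (n : ℕ) :
    ENNReal.ofReal (S.tailSum X α β δ n) =
      ∑ k ∈ Ico 1 n, S.capacity {ω | threshold α β δ (k, n) < |X ω|} := by
  rw [tailSum, ENNReal.ofReal_sum_of_nonneg fun _ _ => ENNReal.toReal_nonneg]
  exact sum_congr rfl fun k _ => ENNReal.ofReal_toReal (capacity_ne_top _)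

theorem one_sub_exp_neg_tailSum_nonneg (α β δ : ℝ) (n : ℕ) :
    0 ≤ 1 - Real.exp (-S.tailSum X α β δ n) :=
  sub_nonneg.2 (Real.exp_le_one_iff.2 (neg_nonpos.2 (tailSum_nonneg α β δ n)))

theorem tailSum_le_tailSum {α β δ : ℝ} (hα : 0 ≤ α) (hδ : 0 ≤ δ) {n m : ℕ}
    (hnm : n ≤ m) (hm : m ≤ 2 * n) :
    S.tailSum X α β (δ * 2 ^ α) n ≤ S.tailSum X α β δ m := by
  have hthreshold (k : ℕ) : threshold α β δ (k, m) ≤ threshold α β (δ * 2 ^ α) (k, n) := calc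
    δ * ((m : ℝ) ^ α * (k : ℝ) ^ (-β)) ≤ δ * ((2 * (n : ℝ)) ^ α * (k : ℝ) ^ (-β)) := by
      gcongr
      exact_mod_cast hm
    _ = δ * 2 ^ α * ((n : ℝ) ^ α * (k : ℝ) ^ (-β)) := by
      rw [Real.mul_rpow two_pos.le n.cast_nonneg]
      ring
  exact (sum_le_sum fun k _ => ENNReal.toReal_mono (capacity_ne_top _)
    (capacity_mono fun _ => (hthreshold k).trans_lt)).trans
      (sum_le_sum_of_subset_of_nonneg (Ico_subset_Ico_right hnm) fun _ _ _ =>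
        ENNReal.toReal_nonneg)

theorem IndepSeq.one_sub_exp_tailSum_le (hindep : S.IndepSeq Xs) (hX : X ∈ S.H)
    (hXs : ∀ n, 1 ≤ n → Xs n ∈ S.H) (hident : ∀ n, 1 ≤ n → S.IdentDistrib (Xs n) X)
    {α c δ : ℝ} (hc : 0 < c) {a : ℕ → ℕ → ℝ} {n : ℕ+}
    (ha : ∀ i < (n : ℕ), c * arrayWeight α β n (n - i) ≤ a n i) :
    ENNReal.ofReal (1 - Real.exp (-S.tailSum X α β δ n)) ≤
      S.capacity {ω | c * δ / 2 < maxAbsWeightedSum a Xs n ω} := by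
  set B : ℕ → Set ℝ := fun i => {y | threshold α β δ ((n : ℕ) - i, n) < |y|}
  have hB (i) : MeasurableSet (B i) := measurableSet_lt measurable_const measurable_id.abs
  have hsum : ∑ i ∈ Icc 1 ((n : ℕ) - 1), (S.capacity (Xs i ⁻¹' B i)).toReal =
      S.tailSum X α β δ n := by
    rw [tailSum, ← sum_Icc_comp_sub]
    exact sum_congr rfl fun i hi => congrArg _
      ((hident i (mem_Icc.1 hi).1).capacity_lt_abs_eq (hXs i (mem_Icc.1 hi).1) hX _)
  have hsubset : ⋃ i ∈ Icc 1 ((n : ℕ) - 1), Xs i ⁻¹' B i ⊆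
      {ω | c * δ / 2 < maxAbsWeightedSum a Xs n ω} :=
    Set.iUnion₂_subset fun i hi ω hω => by
      obtain ⟨hi1, hin⟩ := mem_Icc.1 hi
      exact half_lt_maxAbsWeightedSum hi (mul_lt_abs_mul_of_threshold_lt (by lia) (by lia) hc
        (ha i (by lia)) hω)
  rw [← hsum]
  exact (ENNReal.ofReal_le_of_le_toReal (hindep.one_sub_exp_le_capacity_biUnion hXs hB _)).trans
    (capacity_mono hsubset)

theorem IndepSeq.tsum_one_sub_exp_tailSum_lt_top (hindep : S.IndepSeq Xs) (hX : X ∈ S.H)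
    (hXs : ∀ n, 1 ≤ n → Xs n ∈ S.H) (hident : ∀ n, 1 ≤ n → S.IdentDistrib (Xs n) X)
    {α : ℝ} {a : ℕ → ℕ → ℝ} (ha : ArrayApprox a fun n i => arrayWeight α β n (n - i))
    (hconv : ∀ ε : ℝ, 0 < ε → ∑' n : ℕ+, ENNReal.ofReal (((n : ℕ) : ℝ) ^ (r - 2)) *
      S.capacity {ω | ε < maxAbsWeightedSum a Xs n ω} < ⊤) {δ : ℝ} (hδ : 0 < δ) :
    ∑' n : ℕ, ENNReal.ofReal ((n : ℝ) ^ (r - 2)) *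
      ENNReal.ofReal (1 - Real.exp (-S.tailSum X α β δ n)) < ⊤ := by
  obtain ⟨c, C, hc, -, N, ha⟩ := ha
  set F : ℕ → ℝ≥0∞ := fun n => ENNReal.ofReal ((n : ℝ) ^ (r - 2)) *
    ENNReal.ofReal (1 - Real.exp (-S.tailSum X α β δ n))
  have hF0 : F 0 = 0 := by simp [F, tailSum]
  have hF_eq : ∑' n, F n = ∑' n : ℕ+, F n := by
    rw [tsum_eq_zero_add' ENNReal.summable, hF0, zero_add, tsum_pnat_eq_tsum_succ]
  rw [hF_eq]
  refine tsum_lt_top_of_eventually_le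
    (fun n => ENNReal.mul_ne_top ENNReal.ofReal_ne_top ENNReal.ofReal_ne_top) ?_
    (hconv (c * δ / 2) (by positivity))
  have hN : ∀ᶠ n : ℕ+ in cofinite, N ≤ (n : ℕ) :=
    PNat.coe_injective.tendsto_cofinite.eventually
      (Nat.cofinite_eq_atTop.symm ▸ eventually_ge_atTop N)
  filter_upwards [hN] with n hn
  exact mul_le_mul_right (hindep.one_sub_exp_tailSum_le hX hXs hident hc fun i hi =>
    (ha n hn i hi).1) _

/-- On the dyadic block `(n, 2n]` the tail sums dominate the one at `n`, while the weights of the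
block add up to a quantity tending to infinity. -/
theorem eventually_tailSum_le {α δ : ℝ} (hr : 1 < r) (hα : 0 ≤ α) (hδ : 0 ≤ δ)
    (hfin : ∑' n : ℕ, ENNReal.ofReal ((n : ℝ) ^ (r - 2)) *
      ENNReal.ofReal (1 - Real.exp (-S.tailSum X α β δ n)) < ⊤) :
    ∀ᶠ n in atTop, S.tailSum X α β (δ * 2 ^ α) n ≤ 1 / 2 := by
  set I := ∑' n : ℕ, ENNReal.ofReal ((n : ℝ) ^ (r - 2)) *
    ENNReal.ofReal (1 - Real.exp (-S.tailSum X α β δ n))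
  have hblock (n : ℕ) : (∑ m ∈ Ioc n (2 * n), (m : ℝ) ^ (r - 2)) *
      (1 - Real.exp (-S.tailSum X α β (δ * 2 ^ α) n)) ≤ I.toReal := by
    have hnonneg := one_sub_exp_neg_tailSum_nonneg (S := S) (X := X) α β (δ * 2 ^ α) n
    rw [← ENNReal.ofReal_le_iff_le_toReal hfin.ne, sum_mul,
      ENNReal.ofReal_sum_of_nonneg fun m _ => mul_nonneg (by positivity) hnonneg]
    refine (sum_le_sum fun m hm => ?_).trans (ENNReal.sum_le_tsum (Ioc n (2 * n)))
    obtain ⟨hnm, hm⟩ := mem_Ioc.1 hm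
    rw [ENNReal.ofReal_mul (by positivity)]
    gcongr
    exact tailSum_le_tailSum hα hδ hnm.le hm
  obtain ⟨c, hc, hweights⟩ := exists_le_sum_Ioc_two_mul_rpow (r - 2)
  have hlim : Tendsto (fun n : ℕ => c * (2 * (n : ℝ)) ^ (r - 2 + 1)) atTop atTop :=
    ((tendsto_rpow_atTop (by linarith)).comp
      (tendsto_natCast_atTop_atTop.const_mul_atTop two_pos)).const_mul_atTop hc
  filter_upwards [hlim.eventually_ge_atTop (3 * I.toReal + 1), eventually_ge_atTop 2]
    with n hn hn2
  have hle := (mul_le_mul_of_nonneg_right (hn.trans (hweights n hn2))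
    (one_sub_exp_neg_tailSum_nonneg _ _ _ _)).trans (hblock n)
  refine le_half_of_one_sub_exp_neg_le (not_lt.1 fun h => ?_)
  nlinarith [ENNReal.toReal_nonneg (a := I)]

theorem IndepSeq.lintegral_momentFun_lt_top_of_tsum_capacity_lt_top (hindep : S.IndepSeq Xs)
    (hX : X ∈ S.H) (hXs : ∀ n, 1 ≤ n → Xs n ∈ S.H)
    (hident : ∀ n, 1 ≤ n → S.IdentDistrib (Xs n) X) (hr : 1 < r) (hp : 0 < p) (hα : 0 < p + β)
    {a : ℕ → ℕ → ℝ} (ha : ArrayApprox a fun n i => arrayWeight (p + β) β n (n - i))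
    (hconv : ∀ ε : ℝ, 0 < ε → ∑' n : ℕ+, ENNReal.ofReal (((n : ℕ) : ℝ) ^ (r - 2)) *
      S.capacity {ω | ε < maxAbsWeightedSum a Xs n ω} < ⊤) :
    ∫⁻ y in Set.Ioi (0 : ℝ), S.capacity {ω | y < momentFun r p β |X ω|} < ⊤ := by
  have hfin (δ : ℝ) (hδ : 0 < δ) := hindep.tsum_one_sub_exp_tailSum_lt_top hX hXs hident ha hconv hδ
  have hscale : (0 : ℝ) < ((2 : ℝ) ^ (p + β))⁻¹ := by positivity
  have hsmall := eventually_tailSum_le hr hα.le hscale.le (hfin _ hscale)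
  rw [inv_mul_cancel₀ (by positivity), ← Nat.cofinite_eq_atTop] at hsmall
  refine lintegral_momentFun_lt_top_of_tsum hr hp hα ?_
  rw [tsum_pairWeight_mul]
  simp only [← ofReal_tailSum]
  have htwice : ∑' n : ℕ, 2 * (ENNReal.ofReal ((n : ℝ) ^ (r - 2)) *
      ENNReal.ofReal (1 - Real.exp (-S.tailSum X (p + β) β 1 n))) < ⊤ := by
    rw [ENNReal.tsum_mul_left]
    exact ENNReal.mul_lt_top ENNReal.ofNat_lt_top (hfin 1 one_pos)
  refine tsum_lt_top_of_eventually_le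
    (fun n => ENNReal.mul_ne_top ENNReal.ofReal_ne_top ENNReal.ofReal_ne_top) ?_ htwice
  filter_upwards [hsmall] with n hn
  rw [mul_left_comm, ← ENNReal.ofReal_ofNat, ← ENNReal.ofReal_mul zero_le_two]
  gcongr
  exact le_two_mul_one_sub_exp_neg (tailSum_nonneg _ _ _ _) hn

theorem moment_condition_iff (X : Ω → ℝ) (r p β : ℝ) :
    ((β < -p / r → S.choquet (fun ω => |X ω| ^ ((r - 1) / (p + β))) < ⊤) ∧
      (β = -p / r → S.choquet (fun ω => |X ω| ^ (r / p) * Real.log (1 + |X ω|)) < ⊤) ∧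
      (-p / r < β → S.choquet (fun ω => |X ω| ^ (r / p)) < ⊤)) ↔
    ∫⁻ y in Set.Ioi (0 : ℝ), S.capacity {ω | y < momentFun r p β |X ω|} < ⊤ := by
  rw [← choquet_lt_top_iff fun ω => momentFun_nonneg (abs_nonneg _)]
  rcases lt_trichotomy β (-p / r) with h | h | h
  · simp only [momentFun_of_lt h, h, h.ne, h.not_gt, true_imp_iff, false_imp_iff, and_true]
  · simp only [momentFun_of_eq h, h.not_lt, h.not_gt, false_imp_iff, and_true, true_and]
    exact ⟨fun H => H h, fun H _ => H⟩
  · simp only [momentFun_of_gt h, h, h.ne', h.not_gt, true_imp_iff, false_imp_iff, true_and]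

end SublinearExpectation

end

theorem theorem3p2 {Ω : Type*} [MeasurableSpace Ω] (S : SublinearExpectation Ω)
    (hS : S.CountablySubadditive)
    (X : Ω → ℝ) (Xs : ℕ → Ω → ℝ) (hX : X ∈ S.H) (hXs : ∀ n, 1 ≤ n → Xs n ∈ S.H)
    (hindep : S.IndepSeq Xs) (hident : ∀ n, 1 ≤ n → S.IdentDistrib (Xs n) X)
    (r p β : ℝ) (hr : 1 < r) (hp : 1 / 2 < p) (hβ : 0 < β + p)
    (hmean : p ≤ 1 → S.E X = 0 ∧ -S.E (fun ω => -X ω) = 0)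
    (a : ℕ → ℕ → ℝ)
    (ha : ArrayApprox a
      (fun n i => (((n : ℝ) - (i : ℝ)) / (n : ℝ)) ^ β * (1 / (n : ℝ)) ^ p)) :
    ((β < -p / r → S.choquet (fun ω => |X ω| ^ ((r - 1) / (p + β))) < ⊤) ∧
      (β = -p / r → S.choquet (fun ω => |X ω| ^ (r / p) * Real.log (1 + |X ω|)) < ⊤) ∧
      (-p / r < β → S.choquet (fun ω => |X ω| ^ (r / p)) < ⊤)) ↔
    (∀ ε : ℝ, 0 < ε →
      ∑' n : ℕ+, ENNReal.ofReal (((n : ℕ) : ℝ) ^ (r - 2)) *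
        S.capacity {ω | ε < maxAbsWeightedSum a Xs n ω} < ⊤) := by
  have hα : 0 < p + β := by rwa [add_comm]
  simp only [EReal.neg_eq_zero_iff] at hmean
  rw [arrayApprox_iff_arrayWeight] at ha
  rw [SublinearExpectation.moment_condition_iff]
  exact ⟨fun hmoment _ hε => hS.tsum_capacity_maxAbsWeightedSum_lt_top hX hXs hindep hident hr hp hα
      hmoment hmean ha hε,
    fun hconv => hindep.lintegral_momentFun_lt_top_of_tsum_capacity_lt_top hX hXs hident hr
      (by linarith) hα ha hconv⟩
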